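/- Let $\Gamma$ be a discrete abelian group, written additively. A mean on $\ell^\infty(\Gamma)$ (bounded functions $\Gamma\to\mathbb C$) is a linear functional $m:\ell^\infty(\Gamma)\to\mathbb C$ with $m(1_\Gamma)=1$ and $m(f)\ge 0$ whenever $f\ge 0$; for $A\subseteq\Gamma$ write $m(A):=m(1_A)$, and write $C\subset_m D$ if $m(C\setminus D)=0$. A mean $m$ is invariant if $m(f_\gamma)=m(f)$ for all $f\in\ell^\infty(\Gamma)$ and $\gamma\in\Gamma$, where $f_\gamma(x)=f(x-\gamma)$, and an extreme invariant mean is an extreme point of the convex set of invariant means. A mean $\eta$ is an FS-mean if for every action $(U_\gamma)_{\gamma\in\Gamma}$ of $\Gamma$ by unitary operators on a complex Hilbert space $\mathcal H$ and all $v,w\in\mathcal H$ we have $\eta\big(\gamma\mapsto\langle v,U_\gamma w\rangle\big)=\langle v,Pw\rangle$, where $P$ is the orthogonal projection of $\mathcal H$ onto $\{x\in\mathcal H:U_\gamma x=x\text{ for all }\gamma\in\Gamma\}$. Let $b\Gamma$ be the Bohr compactification of $\Gamma$, that is, the Pontryagin dual of the group of all characters of $\Gamma$ taken with the discrete topology;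 let $\iota:\Gamma\to b\Gamma$, $\iota(\gamma)(\chi)=\chi(\gamma)$, be the canonical embedding, and identify $\Gamma$ with $\iota(\Gamma)$. Let $\mu_{b\Gamma}$ be the Haar probability measure on $b\Gamma$. An $F_\sigma$ set is a countable union of compact sets. Let $\nu$ be an extreme invariant mean on $\ell^\infty(\Gamma)$, $\eta$ an FS-mean on $\ell^\infty(\Gamma)$, and $A,B\subseteq\Gamma$. Then there are $F_\sigma$ sets $\tilde A_\nu,\tilde B_\eta\subseteq b\Gamma$ such that \[ \mu_{b\Gamma}(\tilde A_\nu)\ge\nu(A),\qquad \mu_{b\Gamma}(\tilde B_\eta)\ge\eta(B),\qquad \nu(A+B)\ge\mu_{b\Gamma}(\tilde A_\nu+\tilde B_\eta). \] Furthermore: 1. if $V\subseteq b\Gamma$ is compact, then $\mu_{b\Gamma}(\tilde A_\nu\cap V)\ge\nu(A\cap V)$ and $\mu_{b\Gamma}(\tilde B_\eta\cap V)\ge\eta(B\cap V)$; 2. if $V\subseteq b\Gamma$ is clopen, then $\mu_{b\Gamma}(\tilde A_\nu\cap V)=0\iff\nu(A\cap V)=0$, and $\mu_{b\Gamma}(\tilde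 B_\eta\cap V)=0\iff\eta(B\cap V)=0$; 3. if $V\subseteq\tilde A_\nu+\tilde B_\eta$ is compact, then $V\cap\Gamma\subset_\nu A+B$. -/

import Mathlib

open MeasureTheory Topology
open scoped ENNReal Pointwise ComplexOrder lp

universe u

/-! ### Bounded functions and means -/

/-- The space `ℓ^∞(Γ)` of bounded complex-valued functions on `Γ`, with the supremum norm. -/
abbrev BddFun (Γ : Type u) : Type u := ℓ^∞(Γ, ℂ)

namespace BddFun

variable {Γ : Type u}

/-- A function with `‖f x‖ ≤ C` for all `x`, as an element of `ℓ^∞(Γ)`. -/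
def ofBound (f : Γ → ℂ) (C : ℝ) (hf : ∀ x, ‖f x‖ ≤ C) : BddFun Γ :=
  ⟨f, memℓp_infty ⟨C, by rintro _ ⟨x, rfl⟩; exact hf x⟩⟩

@[simp] theorem ofBound_apply (f : Γ → ℂ) (C : ℝ) (hf : ∀ x, ‖f x‖ ≤ C) (x : Γ) :
    ofBound f C hf x = f x := rfl

/-- The indicator function `1_A`. -/
noncomputable def ind (A : Set Γ) : BddFun Γ :=
  ofBound (A.indicator 1) 1 fun x => by
    by_cases hx : x ∈ A <;> simp [hx]

/-- The translate `f_γ(x) = f(x - γ)`. -/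
noncomputable def translate [AddCommGroup Γ] (γ : Γ) (f : BddFun Γ) : BddFun Γ :=
  ofBound (fun x => f (x - γ)) ‖f‖ fun x => lp.norm_apply_le_norm ENNReal.top_ne_zero f (x - γ)

end BddFun

/-- A mean: a linear functional `m` on `ℓ^∞(Γ)` with `m(1) = 1`, nonnegative on nonnegative
functions (`0 ≤ z` for complex `z` means that `z` is real and nonnegative). -/
structure IsMean {Γ : Type u} (m : BddFun Γ →ₗ[ℂ] ℂ) : Prop where
  map_one : m 1 = 1
  nonneg : ∀ f : BddFun Γ, (∀ x, 0 ≤ f x) → 0 ≤ m f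

/-- The set of translation-invariant means. -/
def invariantMeans (Γ : Type u) [AddCommGroup Γ] : Set (BddFun Γ →ₗ[ℂ] ℂ) :=
  {m | IsMean m ∧ ∀ (γ : Γ) (f : BddFun Γ), m (f.translate γ) = m f}

/-- The set of extreme invariant means. -/
def extremeInvariantMeans (Γ : Type u) [AddCommGroup Γ] : Set (BddFun Γ →ₗ[ℂ] ℂ) :=
  (invariantMeans Γ).extremePoints ℝ

/-- `m(A) = m(1_A)`, as a real number (for a mean, `m(1_A)` is real). -/
noncomputable def meanOf {Γ : Type u} (m : BddFun Γ →ₗ[ℂ] ℂ) (A : Set Γ) : ℝ :=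
  (m (BddFun.ind A)).re

/-- `A ⊂_m B`, that is, `m(A \ B) = 0`. -/
def MeanSubset {Γ : Type u} (m : BddFun Γ →ₗ[ℂ] ℂ) (A B : Set Γ) : Prop :=
  meanOf m (A \ B) = 0

/-! ### Unitary actions and FS-means -/

section Unitary

variable {Γ : Type u} [AddCommGroup Γ]
  {H : Type u} [NormedAddCommGroup H] [InnerProductSpace ℂ H]

/-- The subspace of vectors fixed by every `U_γ`, for a unitary action `U` of `Γ` on `H`. -/
def invariantVectors (U : Multiplicative Γ →* (H ≃ₗᵢ[ℂ] H)) : Submodule ℂ H where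
  carrier := {x | ∀ γ : Γ, U (Multiplicative.ofAdd γ) x = x}
  add_mem' hx hy γ := by rw [map_add, hx γ, hy γ]
  zero_mem' γ := map_zero _
  smul_mem' c x hx γ := by rw [map_smul, hx γ]

theorem isClosed_invariantVectors (U : Multiplicative Γ →* (H ≃ₗᵢ[ℂ] H)) :
    IsClosed (invariantVectors U : Set H) := by
  have h : (invariantVectors U : Set H) = ⋂ γ : Γ, {x | U (Multiplicative.ofAdd γ) x = x} := by
    ext x; simp [invariantVectors]
  rw [h]
  exact isClosed_iInter fun γ =>
    isClosed_eq (U (Multiplicative.ofAdd γ)).continuous continuous_id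

instance [CompleteSpace H] (U : Multiplicative Γ →* (H ≃ₗᵢ[ℂ] H)) :
    CompleteSpace (invariantVectors U) :=
  (isClosed_invariantVectors U).completeSpace_coe

/-- The matrix coefficient `φ_{v,w}(γ) = ⟨v, U_γ w⟩`. -/
noncomputable def matrixCoeff (U : Multiplicative Γ →* (H ≃ₗᵢ[ℂ] H)) (v w : H) : BddFun Γ :=
  BddFun.ofBound (fun γ => inner ℂ v (U (Multiplicative.ofAdd γ) w)) (‖v‖ * ‖w‖) fun γ => by
    simpa using norm_inner_le_norm (𝕜 := ℂ) v (U (Multiplicative.ofAdd γ) w)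

end Unitary

/-- An FS-mean: a mean `η` with `η(φ_{v,w}) = ⟨v, P w⟩` for all matrix coefficients of all unitary
actions on Hilbert spaces, `P` being the orthogonal projection onto the invariant vectors.
Hilbert spaces in the universe of `Γ` suffice, since `φ_{v,w}` only depends on the closed span
of the orbit of `w`. -/
structure IsFSMean {Γ : Type u} [AddCommGroup Γ] (η : BddFun Γ →ₗ[ℂ] ℂ) : Prop where
  isMean : IsMean η
  map_matrixCoeff : ∀ (H : Type u) [NormedAddCommGroup H] [InnerProductSpace ℂ H]
    [CompleteSpace H] (U : Multiplicative Γ →* (H ≃ₗᵢ[ℂ] H)) (v w : H),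
    η (matrixCoeff U v w) = inner ℂ v ((invariantVectors U).starProjection w)

/-! ### The Bohr compactification -/

/-- The Bohr compactification `bΓ`: the Pontryagin dual of the group `AddChar Γ Circle` of all
characters of the discrete group `Γ`, this group being taken with the discrete topology. -/
def BohrCompactification (Γ : Type u) [AddCommGroup Γ] : Type u :=
  AddChar (AddChar Γ Circle) Circle

namespace BohrCompactification

variable {Γ : Type u} [AddCommGroup Γ]

/-- The group operation of `bΓ` is pointwise multiplication of characters, written additively. -/
noncomputable instance : AddCommGroup (BohrCompactification Γ) :=
  inferInstanceAs (AddCommGroup (AddChar (AddChar Γ Circle) Circle))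

/-- The embedding `ι : Γ → bΓ`, `ι(γ)(χ) = χ(γ)`. -/
noncomputable def ι : Γ →+ BohrCompactification Γ :=
  (AddChar.doubleDualEmb : Γ →+ AddChar (AddChar Γ Circle) Circle)

/-- Evaluation of an element of `bΓ` at a character of `Γ`. -/
noncomputable def eval (x : BohrCompactification Γ) (χ : AddChar Γ Circle) : Circle :=
  (show AddChar (AddChar Γ Circle) Circle from x) χ

theorem eval_ι (γ : Γ) (χ : AddChar Γ Circle) : eval (ι γ) χ = χ γ := rfl

theorem eval_add (x y : BohrCompactification Γ) (χ : AddChar Γ Circle) :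
    eval (x + y) χ = eval x χ * eval y χ := rfl

theorem eval_neg (x : BohrCompactification Γ) (χ : AddChar Γ Circle) :
    eval (-x) χ = (eval x χ)⁻¹ :=
  eq_inv_of_mul_eq_one_left (by rw [← eval_add, neg_add_cancel]; rfl)

theorem eval_injective : Function.Injective (eval : BohrCompactification Γ → _) :=
  fun _ _ h => DFunLike.coe_injective (F := AddChar (AddChar Γ Circle) Circle) h

/-- The topology of pointwise convergence on `AddChar Γ Circle`, which is the topology of uniform
convergence on compact sets because `AddChar Γ Circle` is taken to be discrete. -/
noncomputable instance : TopologicalSpace (BohrCompactification Γ) :=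
  TopologicalSpace.induced eval inferInstance

theorem isEmbedding_eval : IsEmbedding (eval : BohrCompactification Γ → _) :=
  ⟨⟨rfl⟩, eval_injective⟩

theorem isClosedEmbedding_eval : IsClosedEmbedding (eval : BohrCompactification Γ → _) := by
  refine ⟨isEmbedding_eval, ?_⟩
  have h : Set.range (eval : BohrCompactification Γ → _) =
      {f : AddChar Γ Circle → Circle | f 0 = 1} ∩
        ⋂ (χ : AddChar Γ Circle) (ψ : AddChar Γ Circle), {f | f (χ + ψ) = f χ * f ψ} := by
    ext f
    simp only [Set.mem_range, Set.mem_inter_iff, Set.mem_ofPred_eq, Set.mem_iInter]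
    constructor
    · rintro ⟨x, rfl⟩
      exact ⟨AddChar.map_zero_eq_one (A := AddChar Γ Circle) x,
        fun χ ψ => AddChar.map_add_eq_mul (A := AddChar Γ Circle) x χ ψ⟩
    · rintro ⟨h0, h1⟩
      exact ⟨(⟨f, h0, h1⟩ : AddChar (AddChar Γ Circle) Circle), rfl⟩
  rw [h]
  refine (isClosed_eq (continuous_apply _) continuous_const).inter
    (isClosed_iInter fun χ => isClosed_iInter fun ψ => isClosed_eq (continuous_apply _) ?_)
  exact (continuous_apply _).mul (continuous_apply _)

instance : CompactSpace (BohrCompactification Γ) := isClosedEmbedding_eval.compactSpace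

instance : T2Space (BohrCompactification Γ) := isEmbedding_eval.t2Space

instance : IsTopologicalAddGroup (BohrCompactification Γ) where
  continuous_add := by
    refine isEmbedding_eval.continuous_iff.2 (continuous_pi fun χ => ?_)
    have h : Continuous fun x : BohrCompactification Γ => eval x χ :=
      (continuous_apply χ).comp isEmbedding_eval.continuous
    exact (h.comp continuous_fst).mul (h.comp continuous_snd)
  continuous_neg := by
    refine isEmbedding_eval.continuous_iff.2 (continuous_pi fun χ => ?_)
    have h : Continuous fun x : BohrCompactification Γ => eval x χ :=
      (continuous_apply χ).comp isEmbedding_eval.continuous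
    have h' : Continuous fun x : BohrCompactification Γ => (eval x χ)⁻¹ := h.inv
    simpa only [Function.comp_def, eval_neg] using h'

noncomputable instance : MeasurableSpace (BohrCompactification Γ) := borel _

instance : BorelSpace (BohrCompactification Γ) := ⟨rfl⟩

/-- The Haar probability measure on `bΓ`. -/
noncomputable def haar (Γ : Type u) [AddCommGroup Γ] : Measure (BohrCompactification Γ) :=
  Measure.addHaarMeasure ⊤

instance : IsProbabilityMeasure (haar Γ) :=
  ⟨Measure.addHaarMeasure_self (K₀ := (⊤ : TopologicalSpace.PositiveCompacts _))⟩

end BohrCompactification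

/-! ### Means -/

/-! Both means restrict to Haar measure on `C(bΓ)`. Hence `φ ↦ ν(1_A φ)` is positive and dominated
by Haar measure, and is given by a density `f` with values in `[0,1]`; let `g` be the density of `B`
for `η` and `k` that of the complement `C` of `A + B` for `ν` (`exists_density`). The sets sought
are, up to null sets, `{f > 0}` and `{g > 0}`.

The heart is the correlation identity `∫ k · (f * g) = 0` (`integral_mul_conv_eq_zero`). The
function `γ ↦ ν(1_C · (1_A)_γ)` vanishes on `B`, so its product with `1_B` has `η`-mean zero. It is
a matrix coefficient of the translation action on `L²(ν)`. An FS-mean ignores coefficients of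
vectors orthogonal to all common eigenvectors (`IsFSMean.map_mul_matrixCoeff_eq_zero`). Extremality
of `ν` makes this action ergodic, so the common eigenvectors are multiples of characters
(`eq_smul_char_of_eigenvector`). Thus `1_A` may be replaced by its projection to the closed span of
the characters, where it acts as `f`. For a continuous `φ` in place of `f` the coefficient is the
restriction of a continuous function on `bΓ`, and its `1_B`-weighted mean is `∫ k · (φ * g)`; an
`L²` approximation of `f` by such `φ` finishes the identity.

The convolution `f * g` is continuous, so `{f * g > 0}` is open, and `C` has `ν`-mean zero against
continuous functions supported there. By a density point argument (`exists_isSigmaCompact_add`), `{f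
> 0}` and `{g > 0}` have σ-compact subsets `A'`, `B'` of full measure with `A' + B' ⊆ {f * g > 0}`.
For a compact `V ⊆ A' + B'`, a Urysohn function equal to `1` on `V` then shows that `V ∩ Γ` lies in
`A + B` up to `ν`-mean zero, and that the measure of `V` is at most `ν(A + B)`. -/

namespace BddFun

variable {Γ : Type u}

@[simp] theorem mul_apply' (f g : BddFun Γ) (x : Γ) : (f * g) x = f x * g x := rfl

@[simp] theorem star_apply' (f : BddFun Γ) (x : Γ) : (star f) x = star (f x) := rfl

@[simp] theorem one_apply' (x : Γ) : (1 : BddFun Γ) x = 1 := rfl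

@[simp] theorem add_apply' (f g : BddFun Γ) (x : Γ) : (f + g) x = f x + g x := rfl

@[simp] theorem sub_apply' (f g : BddFun Γ) (x : Γ) : (f - g) x = f x - g x := rfl

@[simp] theorem smul_apply' (c : ℂ) (f : BddFun Γ) (x : Γ) : (c • f) x = c * f x := rfl

theorem ext' {f g : BddFun Γ} (h : ∀ x, f x = g x) : f = g := lp.ext (funext h)

theorem norm_apply_le (f : BddFun Γ) (x : Γ) : ‖f x‖ ≤ ‖f‖ :=
  lp.norm_apply_le_norm ENNReal.top_ne_zero f x

theorem norm_le_of_forall {f : BddFun Γ} {C : ℝ} (hC : 0 ≤ C) (h : ∀ x, ‖f x‖ ≤ C) : ‖f‖ ≤ C :=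
  lp.norm_le_of_forall_le hC h

theorem ind_apply (A : Set Γ) (x : Γ) : ind A x = A.indicator 1 x := rfl

theorem ind_of_mem {A : Set Γ} {x : Γ} (h : x ∈ A) : ind A x = 1 := by simp [ind_apply, h]

theorem ind_of_notMem {A : Set Γ} {x : Γ} (h : x ∉ A) : ind A x = 0 := by simp [ind_apply, h]

theorem ind_nonneg (A : Set Γ) (x : Γ) : 0 ≤ ind A x := by
  by_cases h : x ∈ A <;> simp [ind_apply, h]

theorem ind_le_one (A : Set Γ) (x : Γ) : ind A x ≤ 1 := by
  by_cases h : x ∈ A <;> simp [ind_apply, h]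

@[simp] theorem star_ind (A : Set Γ) : star (ind A) = ind A := by
  refine ext' fun x => ?_
  by_cases h : x ∈ A <;> simp [ind_apply, h]

theorem star_star_mul (f g : BddFun Γ) : star (star f * g) = star g * f :=
  ext' fun x => by simp [mul_comm]

theorem exists_re_im (f : BddFun Γ) : ∃ a b : BddFun Γ, star a = a ∧ star b = b ∧
    f = a + Complex.I • b ∧ star f = a - Complex.I • b := by
  refine ⟨(1 / 2 : ℂ) • (f + star f), (-Complex.I / 2) • (f - star f), ?_, ?_, ?_, ?_⟩ <;>
    refine ext' fun x => ?_
  · simp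
    ring
  · simp
    ring
  all_goals
    simp
    ring_nf
    simp
    ring

@[simp] theorem translate_apply [AddCommGroup Γ] (γ : Γ) (f : BddFun Γ) (x : Γ) :
    f.translate γ x = f (x - γ) := rfl

end BddFun

namespace IsMean

variable {Γ : Type u} {m : BddFun Γ →ₗ[ℂ] ℂ}

theorem mono (hm : IsMean m) {f g : BddFun Γ} (h : ∀ x, f x ≤ g x) : m f ≤ m g := by
  have := hm.nonneg (g - f) fun x => by simpa using h x
  rwa [map_sub, sub_nonneg] at this

theorem map_star (hm : IsMean m) (f : BddFun Γ) : m (star f) = star (m f) := by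
  have key : ∀ g : BddFun Γ, star g = g → star (m g) = m g := by
    intro g hg
    -- A self-adjoint `g` becomes nonnegative after adding the constant `‖g‖`, so `m g` is a
    -- difference of two reals.
    have h1 : 0 ≤ m (g + (‖g‖ : ℂ) • (1 : BddFun Γ)) := hm.nonneg _ fun x => by
      have hr : star (g x) = g x := by
        conv_rhs => rw [← hg]
        rfl
      have hre : ((g x).re : ℂ) = g x := Complex.conj_eq_iff_re.1 hr
      have h2 := BddFun.norm_apply_le g x
      have h3 := Complex.abs_re_le_norm (g x)
      have h4 : 0 ≤ (g x).re + ‖g‖ := by linarith [neg_abs_le (g x).re]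
      simp only [BddFun.add_apply', BddFun.smul_apply', BddFun.one_apply', mul_one]
      rw [← hre]
      exact_mod_cast h4
    rw [map_add, map_smul, hm.map_one] at h1
    have h5 := (Complex.nonneg_iff.1 h1).2
    simp at h5
    exact Complex.conj_eq_iff_im.2 h5.symm
  obtain ⟨a, b, ha, hb, e, e'⟩ := f.exists_re_im
  rw [e', e, map_sub, map_add, star_add, key a ha, map_smul m Complex.I, smul_eq_mul, star_mul,
    key b hb]
  simp
  ring

/-- **Cauchy–Schwarz** for means. -/
theorem norm_sq_le (hm : IsMean m) (f g : BddFun Γ) :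
    ‖m (star f * g)‖ ^ 2 ≤ (m (star f * f)).re * (m (star g * g)).re := by
  -- The form `m(f̄ g)` may be degenerate; semidefiniteness is all that Cauchy–Schwarz needs.
  let core : PreInnerProductSpace.Core ℂ (BddFun Γ) :=
    { inner := fun a b => m (star a * b)
      conj_inner_symm := fun a b => by
        change (starRingEnd ℂ) (m (star b * a)) = m (star a * b)
        rw [starRingEnd_apply, ← hm.map_star, BddFun.star_star_mul]
      re_inner_nonneg := fun a =>
        (Complex.nonneg_iff.1 (hm.nonneg (star a * a) fun x => star_mul_self_nonneg (a x))).1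
      add_left := fun a b c => by
        change m (star (a + b) * c) = m (star a * c) + m (star b * c)
        rw [star_add, add_mul, map_add]
      smul_left := fun a b r => by
        change m (star (r • a) * b) = (starRingEnd ℂ) r * m (star a * b)
        rw [star_smul, smul_mul_assoc, map_smul]; rfl }
  have h := @InnerProductSpace.Core.inner_mul_inner_self_le ℂ (BddFun Γ) _ _ _ core f g
  have h' : ‖m (star f * g)‖ * ‖m (star g * f)‖ ≤ (m (star f * f)).re * (m (star g * g)).re := h
  have e : m (star g * f) = star (m (star f * g)) := by
    rw [← hm.map_star, BddFun.star_star_mul]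
  rw [e, norm_star] at h'
  rwa [sq]

theorem norm_le (hm : IsMean m) (f : BddFun Γ) : ‖m f‖ ≤ ‖f‖ := by
  have h := hm.norm_sq_le 1 f
  rw [star_one, one_mul, mul_one, hm.map_one] at h
  have h2 : m (star f * f) ≤ m (((‖f‖ ^ 2 : ℝ) : ℂ) • (1 : BddFun Γ)) := hm.mono fun x => by
    simp only [BddFun.mul_apply', BddFun.star_apply', BddFun.smul_apply', BddFun.one_apply',
      mul_one]
    rw [Complex.star_def, Complex.conj_mul', ← Complex.ofReal_pow, Complex.real_le_real]
    gcongr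
    exact BddFun.norm_apply_le f x
  rw [map_smul, hm.map_one] at h2
  have h3 := (Complex.le_def.1 h2).1
  simp only [smul_eq_mul, mul_one, Complex.ofReal_re] at h3
  simp only [Complex.one_re, one_mul] at h
  exact (sq_le_sq₀ (norm_nonneg _) (norm_nonneg f)).1 (h.trans h3)

theorem continuous (hm : IsMean m) : Continuous m :=
  (m.mkContinuous 1 fun f => by simpa using hm.norm_le f).continuous

theorem norm_le_of_forall (hm : IsMean m) {f : BddFun Γ} {C : ℝ} (hC : 0 ≤ C)
    (h : ∀ x, ‖f x‖ ≤ C) : ‖m f‖ ≤ C :=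
  (hm.norm_le f).trans (BddFun.norm_le_of_forall hC h)

theorem nonneg_meanOf (hm : IsMean m) (A : Set Γ) : 0 ≤ meanOf m A :=
  (Complex.nonneg_iff.1 (hm.nonneg _ (BddFun.ind_nonneg A))).1

/-- A function whose square has mean zero is negligible. -/
theorem map_mul_eq_zero (hm : IsMean m) {f : BddFun Γ} (hf : m (star f * f) = 0) (g : BddFun Γ) :
    m (g * f) = 0 := by
  have h := hm.norm_sq_le (star g) f
  rw [hf, star_star, Complex.zero_re, mul_zero] at h
  exact norm_eq_zero.1 (pow_eq_zero_iff (two_ne_zero)|>.1 (le_antisymm h (by positivity)))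

end IsMean

/-! ### Extending unitary actions to completions -/

section Completion

open UniformSpace

variable {E : Type*} [SeminormedAddCommGroup E] [InnerProductSpace ℂ E]

/-- The extension of a linear isometric equivalence to the completion. -/
noncomputable def LinearIsometryEquiv.completion (e : E ≃ₗᵢ[ℂ] E) :
    Completion E ≃ₗᵢ[ℂ] Completion E where
  toFun := (e : E →L[ℂ] E).completion
  invFun := (e.symm : E →L[ℂ] E).completion
  map_add' x y := (e : E →L[ℂ] E).completion.map_add x y
  map_smul' c x := (e : E →L[ℂ] E).completion.map_smul c x
  left_inv x := by
    induction x using Completion.induction_on with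
    | hp => exact isClosed_eq (by fun_prop) continuous_id
    | ih a => simp
  right_inv x := by
    induction x using Completion.induction_on with
    | hp => exact isClosed_eq (by fun_prop) continuous_id
    | ih a => simp
  norm_map' x := by
    change ‖(e : E →L[ℂ] E).completion x‖ = ‖x‖
    induction x using Completion.induction_on with
    | hp => exact isClosed_eq (by fun_prop) (by fun_prop)
    | ih a => simp

@[simp] theorem LinearIsometryEquiv.completion_coe (e : E ≃ₗᵢ[ℂ] E) (a : E) :
    e.completion (a : Completion E) = (e a : Completion E) :=
  ContinuousLinearMap.completion_apply_coe (e : E →L[ℂ] E) a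

theorem LinearIsometryEquiv.ext_of_coe {e e' : Completion E ≃ₗᵢ[ℂ] Completion E}
    (h : ∀ a : E, e (a : Completion E) = e' (a : Completion E)) : e = e' := by
  ext x
  induction x using Completion.induction_on with
  | hp => exact isClosed_eq e.continuous e'.continuous
  | ih a => exact h a

/-- The extension of a unitary action to the completion. -/
noncomputable def completionAction {G : Type*} [Monoid G] (U : G →* (E ≃ₗᵢ[ℂ] E)) :
    G →* (Completion E ≃ₗᵢ[ℂ] Completion E) where
  toFun g := (U g).completion
  map_one' := LinearIsometryEquiv.ext_of_coe fun a => by simp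
  map_mul' g g' := LinearIsometryEquiv.ext_of_coe fun a => by simp

theorem completionAction_coe {G : Type*} [Monoid G] (U : G →* (E ≃ₗᵢ[ℂ] E)) (g : G) (a : E) :
    completionAction U g (a : Completion E) = (U g a : Completion E) :=
  (U g).completion_coe a

end Completion

/-! ### Products of matrix coefficients and the tensor square of an action -/

section Unitary

variable {Γ : Type u} [AddCommGroup Γ]
  {H : Type u} [NormedAddCommGroup H] [InnerProductSpace ℂ H]

open Multiplicative UniformSpace TensorProduct

theorem matrixCoeff_apply (U : Multiplicative Γ →* (H ≃ₗᵢ[ℂ] H)) (v w : H) (γ : Γ) :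
    matrixCoeff U v w γ = inner ℂ v (U (ofAdd γ) w) := rfl

theorem unitary_add_apply (U : Multiplicative Γ →* (H ≃ₗᵢ[ℂ] H)) (γ δ : Γ) (w : H) :
    U (ofAdd (γ + δ)) w = U (ofAdd γ) (U (ofAdd δ) w) := by
  rw [ofAdd_add, map_mul]; rfl

theorem inner_unitary_left (U : Multiplicative Γ →* (H ≃ₗᵢ[ℂ] H)) (γ : Γ) (v w : H) :
    inner ℂ (U (ofAdd γ) v) w = inner ℂ v (U (ofAdd (-γ)) w) := by
  rw [← (U (ofAdd (-γ))).inner_map_map, ← unitary_add_apply, neg_add_cancel, ofAdd_zero, map_one]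
  rfl

/-- The action `γ ↦ U_γ ⊗ U_{-γ}` on `H ⊗ H`. -/
noncomputable def tensorAction (U : Multiplicative Γ →* (H ≃ₗᵢ[ℂ] H)) :
    Multiplicative Γ →* ((H ⊗[ℂ] H) ≃ₗᵢ[ℂ] (H ⊗[ℂ] H)) where
  toFun γ := congrIsometry (U γ) (U γ⁻¹)
  map_one' := by
    rw [inv_one, map_one]
    exact congrIsometry_refl_refl
  map_mul' a b := by
    ext x
    induction x using TensorProduct.induction_on with
    | zero => simp
    | add x y hx hy => rw [map_add, hx, hy, map_add]
    | tmul x y =>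
      -- Commutativity of `Γ` enters here: it makes `γ ↦ U_{-γ}` a homomorphism, which takes the
      -- place of the conjugate representation.
      rw [mul_inv, map_mul, map_mul]
      rfl

theorem tensorAction_tmul (U : Multiplicative Γ →* (H ≃ₗᵢ[ℂ] H)) (γ : Γ) (v w : H) :
    tensorAction U (ofAdd γ) (v ⊗ₜ[ℂ] w) = (U (ofAdd γ) v) ⊗ₜ[ℂ] (U (ofAdd (-γ)) w) := rfl

/-- The product `⟨v, U_γ w⟩⟨U_γ w', v'⟩` of matrix coefficients. -/
noncomputable def coeffMul (U : Multiplicative Γ →* (H ≃ₗᵢ[ℂ] H)) (v w w' v' : H) : BddFun Γ :=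
  matrixCoeff U v w * star (matrixCoeff U v' w')

theorem coeffMul_apply (U : Multiplicative Γ →* (H ≃ₗᵢ[ℂ] H)) (v w w' v' : H) (γ : Γ) :
    coeffMul U v w w' v' γ = inner ℂ v (U (ofAdd γ) w) * inner ℂ (U (ofAdd γ) w') v' := by
  rw [coeffMul, BddFun.mul_apply', BddFun.star_apply', matrixCoeff_apply, matrixCoeff_apply,
    ← starRingEnd_apply, inner_conj_symm]

/-- Since `⟨U_γ w', v'⟩ = ⟨w', U_{-γ} v'⟩`, the vectors `w'` and `v'` trade sides. The completion is
taken because the defining property of FS-means concerns complete spaces only. -/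
theorem coeffMul_eq_matrixCoeff (U : Multiplicative Γ →* (H ≃ₗᵢ[ℂ] H)) (v w w' v' : H) :
    coeffMul U v w w' v' = matrixCoeff (completionAction (tensorAction U))
      ((v ⊗ₜ[ℂ] w' : H ⊗[ℂ] H) : Completion (H ⊗[ℂ] H))
      ((w ⊗ₜ[ℂ] v' : H ⊗[ℂ] H) : Completion (H ⊗[ℂ] H)) := by
  refine BddFun.ext' fun γ => ?_
  rw [coeffMul_apply, matrixCoeff_apply, completionAction_coe, Completion.inner_coe,
    inner_unitary_left, tensorAction_tmul, inner_tmul]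

variable {η : BddFun Γ →ₗ[ℂ] ℂ}

/-- The vector `U_δ w - w` is orthogonal to every invariant vector, so the projection does not see
it. An FS-mean is not assumed translation invariant; this is the invariance it has on matrix
coefficients. -/
theorem IsFSMean.map_matrixCoeff_unitary [CompleteSpace H] (hη : IsFSMean η)
    (U : Multiplicative Γ →* (H ≃ₗᵢ[ℂ] H)) (v w : H) (δ : Γ) :
    η (matrixCoeff U v (U (ofAdd δ) w)) = η (matrixCoeff U v w) := by
  have key : (invariantVectors U).starProjection (U (ofAdd δ) w) =
      (invariantVectors U).starProjection w := by
    rw [← sub_eq_zero, ← map_sub, Submodule.starProjection_apply_eq_zero_iff]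
    intro x hx
    rw [inner_sub_right]
    nth_rewrite 1 [← hx δ]
    rw [LinearIsometryEquiv.inner_map_map, sub_self]
  rw [hη.map_matrixCoeff, hη.map_matrixCoeff, key]

/-- Invariance for the tensor action moves `w ⊗ v'` to `U_δ w ⊗ U_{-δ} v'`, and `U_{-δ}` then passes
across the inner product to become `U_δ` on `w'`. -/
theorem IsFSMean.map_coeffMul_unitary (hη : IsFSMean η)
    (U : Multiplicative Γ →* (H ≃ₗᵢ[ℂ] H)) (v w w' v' : H) (δ : Γ) :
    η (coeffMul U v (U (ofAdd δ) w) (U (ofAdd δ) w') v') = η (coeffMul U v w w' v') := by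
  rw [show coeffMul U v (U (ofAdd δ) w) (U (ofAdd δ) w') v' =
    matrixCoeff (completionAction (tensorAction U))
      ((v ⊗ₜ[ℂ] w' : H ⊗[ℂ] H) : Completion (H ⊗[ℂ] H))
      (completionAction (tensorAction U) (ofAdd δ)
        ((w ⊗ₜ[ℂ] v' : H ⊗[ℂ] H) : Completion (H ⊗[ℂ] H))) from ?_,
    hη.map_matrixCoeff_unitary, coeffMul_eq_matrixCoeff]
  rw [completionAction_coe]
  rw [tensorAction_tmul, ← coeffMul_eq_matrixCoeff]
  refine BddFun.ext' fun γ => ?_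
  rw [coeffMul_apply, coeffMul_apply]
  congr 1
  rw [← unitary_add_apply, add_comm, unitary_add_apply, inner_unitary_left]

end Unitary

/-! ### Common eigenvectors and finite-dimensionality from a trace bound -/

section FiniteDimensional

variable {H : Type*} [NormedAddCommGroup H] [InnerProductSpace ℂ H]

/-- A commuting family of endomorphisms which leaves a nonzero finite-dimensional subspace invariant
has a common eigenvector in it. -/
theorem exists_common_eigenvector {V : Type*} [AddCommGroup V] [Module ℂ V] {ι : Type*}
    (T : ι → Module.End ℂ V) (hT : ∀ i j, Commute (T i) (T j)) :
    ∀ (n : ℕ) (E : Submodule ℂ V) [FiniteDimensional ℂ E], Module.finrank ℂ E = n → E ≠ ⊥ →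
      (∀ i, ∀ x ∈ E, T i x ∈ E) → ∃ e ∈ E, e ≠ 0 ∧ ∃ c : ι → ℂ, ∀ i, T i e = c i • e := by
  intro n
  induction n using Nat.strong_induction_on with
  | _ n ih =>
    intro E _ hn hE hinv
    by_cases hall : ∀ i, ∃ c : ℂ, ∀ x ∈ E, T i x = c • x
    · choose c hc using hall
      obtain ⟨e, he, he0⟩ := Submodule.exists_mem_ne_zero_of_ne_bot hE
      exact ⟨e, he, he0, c, fun i => hc i e he⟩
    · push Not at hall
      obtain ⟨i, hi⟩ := hall
      have : Nontrivial E := Submodule.nontrivial_iff_ne_bot.2 hE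
      obtain ⟨c, hc⟩ := Module.End.exists_eigenvalue ((T i).restrict (hinv i))
      obtain ⟨x, hx⟩ := hc.exists_hasEigenvector
      -- As `T i` is not scalar on `E`, this eigenspace is nonzero and proper in `E`; it is stable
      -- under the other operators because they commute with `T i`, so induction on the dimension
      -- applies.
      let F : Submodule ℂ V := E ⊓ Module.End.eigenspace (T i) c
      have hFE : F ≤ E := inf_le_left
      have hFlt : F < E := by
        refine lt_of_le_of_ne hFE fun h => ?_
        obtain ⟨y, hy, hy'⟩ := hi c
        rw [← h] at hy
        exact hy' (Module.End.mem_eigenspace_iff.1 hy.2)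
      have hF : F ≠ ⊥ := by
        refine (Submodule.ne_bot_iff F).2 ⟨x, ⟨x.2, ?_⟩, fun h => hx.2 (Subtype.ext h)⟩
        exact Module.End.mem_eigenspace_iff.2 (congrArg Subtype.val hx.apply_eq_smul)
      have : FiniteDimensional ℂ F := Submodule.finiteDimensional_of_le hFE
      obtain ⟨e, he, h⟩ := ih (Module.finrank ℂ F)
        (hn ▸ Submodule.finrank_lt_finrank_of_lt hFlt) F rfl hF fun j y hy => ⟨hinv j y hy.1, by
          rw [SetLike.mem_coe, Module.End.mem_eigenspace_iff] at *
          have h1 : T i (T j y) = T j (T i y) := LinearMap.congr_fun (hT i j) y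
          rw [h1, Module.End.mem_eigenspace_iff.1 hy.2, map_smul]⟩
      exact ⟨e, hFE he, h⟩

/-- A positive operator of finite trace which is bounded below on a subspace forces the subspace to
be finite-dimensional. -/
theorem finiteDimensional_of_trace_bound (q : H → ℝ) {M δ : ℝ} (hδ : 0 < δ)
    (hq : ∀ (n : ℕ) (e : Fin n → H), Orthonormal ℂ e → ∑ i, q (e i) ≤ M)
    (E : Submodule ℂ H) (hE : ∀ x ∈ E, δ * ‖x‖ ^ 2 ≤ q x) : FiniteDimensional ℂ E := by
  -- Each vector of an orthonormal basis contributes at least `δ` to a sum bounded by `M`.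
  -- Finite-dimensional subspaces of `E` are bounded first, and the rank of `E` then through spans
  -- of finite independent families.
  have key : ∀ F : Submodule ℂ H, F ≤ E → FiniteDimensional ℂ F →
      Module.finrank ℂ F ≤ ⌊M / δ⌋₊ := by
    intro F hF hfin
    let b := stdOrthonormalBasis ℂ F
    have h1 := hq _ (fun i => (b i : H)) (b.orthonormal.comp_linearIsometry F.subtypeₗᵢ)
    have h2 : ∑ _i : Fin (Module.finrank ℂ F), δ ≤ ∑ i, q (b i : H) := by
      refine Finset.sum_le_sum fun i _ => ?_
      have h3 := hE _ (hF (b i).2)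
      have h4 : ‖(b i : H)‖ = 1 := b.orthonormal.1 i
      rwa [h4, one_pow, mul_one] at h3
    rw [Finset.sum_const, Finset.card_univ, Fintype.card_fin, nsmul_eq_mul] at h2
    exact Nat.le_floor ((le_div_iff₀ hδ).2 (h2.trans h1))
  have hrank : Module.rank ℂ E ≤ (⌊M / δ⌋₊ : ℕ) := by
    refine rank_le fun s hs => ?_
    have h5 : LinearIndependent ℂ (fun i : s => ((i : E) : H)) :=
      hs.map' E.subtype (Submodule.ker_subtype E)
    have h6 := finrank_span_eq_card h5
    rw [Fintype.card_coe] at h6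
    rw [← h6]
    refine key _ ?_ (FiniteDimensional.span_of_finite ℂ (Set.finite_range _))
    rw [Submodule.span_le]
    rintro _ ⟨i, rfl⟩
    exact (i : E).2
  exact Module.rank_lt_aleph0_iff.1 (hrank.trans_lt Cardinal.natCast_lt_aleph0)

end FiniteDimensional

/-! ### The averaged rank one operator and the coefficients ignored by FS-means -/

section Unitary

open Multiplicative

variable {Γ : Type u} [AddCommGroup Γ]
  {H : Type u} [NormedAddCommGroup H] [InnerProductSpace ℂ H]
variable {η : BddFun Γ →ₗ[ℂ] ℂ}

theorem norm_matrixCoeff_le (U : Multiplicative Γ →* (H ≃ₗᵢ[ℂ] H)) (v w : H) (γ : Γ) :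
    ‖matrixCoeff U v w γ‖ ≤ ‖v‖ * ‖w‖ := by
  simpa [matrixCoeff_apply] using norm_inner_le_norm (𝕜 := ℂ) v (U (ofAdd γ) w)

theorem matrixCoeff_add_left (U : Multiplicative Γ →* (H ≃ₗᵢ[ℂ] H)) (v v' w : H) :
    matrixCoeff U (v + v') w = matrixCoeff U v w + matrixCoeff U v' w :=
  BddFun.ext' fun γ => by simp [matrixCoeff_apply]

theorem matrixCoeff_smul_left (U : Multiplicative Γ →* (H ≃ₗᵢ[ℂ] H)) (c : ℂ) (v w : H) :
    matrixCoeff U (c • v) w = star c • matrixCoeff U v w :=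
  BddFun.ext' fun γ => by simp [matrixCoeff_apply, mul_comm]

theorem matrixCoeff_add_right (U : Multiplicative Γ →* (H ≃ₗᵢ[ℂ] H)) (v w w' : H) :
    matrixCoeff U v (w + w') = matrixCoeff U v w + matrixCoeff U v w' :=
  BddFun.ext' fun γ => by simp [matrixCoeff_apply]

theorem matrixCoeff_smul_right (U : Multiplicative Γ →* (H ≃ₗᵢ[ℂ] H)) (c : ℂ) (v w : H) :
    matrixCoeff U v (c • w) = c • matrixCoeff U v w :=
  BddFun.ext' fun γ => by simp [matrixCoeff_apply]

/-- The sesquilinear form `(v, v') ↦ η(⟨v, U_γ w⟩⟨U_γ w, v'⟩)`. -/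
noncomputable def coeffForm (hη : IsMean η) (U : Multiplicative Γ →* (H ≃ₗᵢ[ℂ] H)) (w : H) :
    H →L⋆[ℂ] H →L[ℂ] ℂ :=
  LinearMap.mkContinuous₂
    (LinearMap.mk₂'ₛₗ (starRingEnd ℂ) (RingHom.id ℂ) (fun v v' => η (coeffMul U v w w v'))
      (fun v₁ v₂ v' => by
        rw [← map_add]; congr 1
        rw [coeffMul, matrixCoeff_add_left, add_mul]; rfl)
      (fun c v v' => by
        rw [← map_smul η]; congr 1
        rw [coeffMul, matrixCoeff_smul_left, smul_mul_assoc]; rfl)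
      (fun v v₁ v₂ => by
        rw [← map_add]; congr 1
        rw [coeffMul, matrixCoeff_add_left, star_add, mul_add]; rfl)
      (fun c v v' => by
        rw [RingHom.id_apply, ← map_smul]; congr 1
        rw [coeffMul, matrixCoeff_smul_left, star_smul, star_star, mul_smul_comm]; rfl))
    (‖w‖ ^ 2) (fun v v' => by
      refine hη.norm_le_of_forall (by positivity) fun γ => ?_
      rw [coeffMul, BddFun.mul_apply', BddFun.star_apply', norm_mul, norm_star]
      calc _ ≤ (‖v‖ * ‖w‖) * (‖v'‖ * ‖w‖) := by
            gcongr <;> exact norm_matrixCoeff_le ..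
        _ = _ := by ring)

variable [CompleteSpace H]

/-- The mean of the rank one operators `|U_γ w⟩⟨U_γ w|`. -/
noncomputable def meanOperator (hη : IsMean η) (U : Multiplicative Γ →* (H ≃ₗᵢ[ℂ] H)) (w : H) :
    H →L[ℂ] H :=
  InnerProductSpace.continuousLinearMapOfBilin (coeffForm hη U w)

theorem inner_meanOperator (hη : IsMean η) (U : Multiplicative Γ →* (H ≃ₗᵢ[ℂ] H)) (w v v' : H) :
    inner ℂ (meanOperator hη U w v) v' = η (coeffMul U v w w v') :=
  InnerProductSpace.continuousLinearMapOfBilin_apply _ _ _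

theorem isPositive_meanOperator (hη : IsMean η) (U : Multiplicative Γ →* (H ≃ₗᵢ[ℂ] H)) (w : H) :
    (meanOperator hη U w).IsPositive := by
  rw [ContinuousLinearMap.isPositive_iff_complex]
  intro v
  have h : 0 ≤ (inner ℂ (meanOperator hη U w v) v : ℂ) := by
    rw [inner_meanOperator]
    refine hη.nonneg _ fun γ => ?_
    rw [coeffMul, BddFun.mul_apply', BddFun.star_apply']
    exact mul_star_self_nonneg _
  have h1 := Complex.nonneg_iff.1 h
  exact ⟨Complex.ext (by simp) (by simpa using h1.2), h1.1⟩

/-- Conjugating by `U_δ` replaces `w` by a translate in both coefficients, which the mean does not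
notice by `IsFSMean.map_coeffMul_unitary`. -/
theorem meanOperator_commute (hη : IsFSMean η) (U : Multiplicative Γ →* (H ≃ₗᵢ[ℂ] H)) (w : H)
    (δ : Γ) : Commute (meanOperator hη.isMean U w) ((U (ofAdd δ) : H →L[ℂ] H)) := by
  ext v
  refine ext_inner_right ℂ fun v' => ?_
  change inner ℂ (meanOperator hη.isMean U w (U (ofAdd δ) v)) v' =
    inner ℂ (U (ofAdd δ) (meanOperator hη.isMean U w v)) v'
  rw [inner_unitary_left, inner_meanOperator, inner_meanOperator,
    ← hη.map_coeffMul_unitary U _ w w _ δ]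
  congr 1
  refine BddFun.ext' fun γ => ?_
  rw [coeffMul_apply, coeffMul_apply, ← unitary_add_apply, add_comm, unitary_add_apply,
    LinearIsometryEquiv.inner_map_map, inner_unitary_left U δ]

/-- Bessel's inequality for `U_γ w`, at each `γ`, averaged by `η`. This is the bound by `‖w‖²` on
the trace. -/
theorem sum_meanOperator_le (hη : IsMean η) (U : Multiplicative Γ →* (H ≃ₗᵢ[ℂ] H)) (w : H)
    (n : ℕ) (e : Fin n → H) (he : Orthonormal ℂ e) :
    ∑ i, (inner ℂ (meanOperator hη U w (e i)) (e i) : ℂ).re ≤ ‖w‖ ^ 2 := by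
  simp_rw [inner_meanOperator]
  rw [← Complex.re_sum, ← map_sum]
  have h : η (∑ i, coeffMul U (e i) w w (e i)) ≤ η (((‖w‖ ^ 2 : ℝ) : ℂ) • (1 : BddFun Γ)) := by
    refine hη.mono fun γ => ?_
    have h1 : (∑ i, coeffMul U (e i) w w (e i)) γ =
        ((∑ i, ‖(inner ℂ (e i) (U (ofAdd γ) w) : ℂ)‖ ^ 2 : ℝ) : ℂ) := by
      rw [lp.coeFn_sum, Finset.sum_apply, Complex.ofReal_sum]
      refine Finset.sum_congr rfl fun i _ => ?_
      rw [coeffMul_apply, ← inner_conj_symm (U (ofAdd γ) w) (e i), Complex.mul_conj']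
      push_cast; rfl
    rw [h1, BddFun.smul_apply', BddFun.one_apply', mul_one, Complex.real_le_real]
    have h2 := he.sum_inner_products_le (U (ofAdd γ) w) (s := Finset.univ)
    rwa [LinearIsometryEquiv.norm_map] at h2
  rw [map_smul, hη.map_one] at h
  rw [smul_eq_mul, mul_one] at h
  exact (Complex.le_def.1 h).1

open scoped ContinuousFunctionalCalculus in
-- A nonzero positive operator of finite trace has a nonzero finite-dimensional spectral subspace
-- away from `0`. It is stable under the commuting unitaries, hence contains a common eigenvector
-- `e`; but `e` is orthogonal to the whole orbit of `w`, on which the operator is built, so its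
-- quadratic form vanishes at `e`.
theorem meanOperator_eq_zero (hη : IsFSMean η) (U : Multiplicative Γ →* (H ≃ₗᵢ[ℂ] H)) (w : H)
    (hw : ∀ (e : H) (c : Γ → ℂ), (∀ γ, U (ofAdd γ) e = c γ • e) → inner ℂ e w = (0 : ℂ)) :
    meanOperator hη.isMean U w = 0 := by
  by_contra hS
  set S := meanOperator hη.isMean U w with hSdef
  have hpos : S.IsPositive := isPositive_meanOperator hη.isMean U w
  have hsa : IsSelfAdjoint S := hpos.isSelfAdjoint
  have hSnonneg : 0 ≤ S := (ContinuousLinearMap.nonneg_iff_isPositive S).2 hpos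
  set δ : ℝ := ‖S‖ / 2 with hδ
  have hnS : 0 < ‖S‖ := norm_pos_iff.2 hS
  have hδ0 : 0 < δ := by positivity
  -- A continuous substitute for the spectral projection onto `(δ, ∞)`; `δ` is strictly below `‖S‖`,
  -- so that the cut-off operator does not vanish.
  let f : ℝ → ℝ := fun t => max (t - δ) 0
  have hf : Continuous f := by fun_prop
  set F : H →L[ℂ] H := cfc f S with hF
  have hFsa : IsSelfAdjoint F := cfc_predicate f S
  have hF0 : F ≠ 0 := by
    intro h0
    -- On the spectrum `t - f t = min t δ` lies in `[0, δ]`, so `F = 0` would force `‖S‖ ≤ δ`.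
    have h1 : S = cfc (fun t : ℝ => t - f t) S := by
      rw [cfc_sub (fun t : ℝ => t) f S, ← hF, h0, sub_zero, cfc_id' ℝ S]
    have h2 : ‖S‖ ≤ δ := by
      conv_lhs => rw [h1]
      refine norm_cfc_le hδ0.le fun t ht => ?_
      have ht0 : 0 ≤ t := spectrum_nonneg_of_nonneg hSnonneg ht
      simp only [f, Real.norm_eq_abs]
      rcases max_cases (t - δ) 0 with ⟨h, h'⟩ | ⟨h, h'⟩ <;> rw [h, abs_le] <;>
        constructor <;> linarith
    linarith
  have hlow : ∀ x ∈ (F : H →ₗ[ℂ] H).range, δ * ‖x‖ ^ 2 ≤ (inner ℂ (S x) x : ℂ).re := by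
    rintro _ ⟨u, rfl⟩
    -- The function `f(t)² (t - δ)` is nonnegative because `f` vanishes for `t ≤ δ`; this says that
    -- `S ≥ δ` on the range of `F`.
    have hFS : 0 ≤ F * (S - algebraMap ℝ _ δ) * F := by
      have : F * (S - algebraMap ℝ _ δ) * F = cfc (fun t : ℝ => f t * (t - δ) * f t) S := by
        rw [cfc_mul (fun t => f t * (t - δ)) f S, cfc_mul f (fun t => t - δ) S,
          cfc_sub (fun t => t) (fun _ => δ) S, cfc_id' ℝ S, cfc_const δ S]
      rw [this]
      refine cfc_nonneg fun t _ => ?_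
      simp only [f]
      rcases max_cases (t - δ) 0 with ⟨h, h'⟩ | ⟨h, h'⟩ <;> rw [h]
      · positivity
      · simp
    have h3 := ((ContinuousLinearMap.nonneg_iff_isPositive _).1 hFS).re_inner_nonneg_left u
    have h4 : inner ℂ ((F * (S - algebraMap ℝ _ δ) * F) u) u =
        inner ℂ (S (F u)) (F u) - (δ : ℂ) * inner ℂ (F u) (F u) := by
      change inner ℂ (F ((S - algebraMap ℝ _ δ) (F u))) u = _
      rw [← ContinuousLinearMap.adjoint_inner_right, hFsa.adjoint_eq]
      have : (S - algebraMap ℝ (H →L[ℂ] H) δ) (F u) = S (F u) - (δ : ℂ) • F u := by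
        simp [Algebra.algebraMap_eq_smul_one]
      rw [this, inner_sub_left, inner_smul_left]
      simp
    rw [h4] at h3
    rw [inner_self_eq_norm_sq_to_K] at h3
    have h5 : RCLike.re ((inner ℂ (S (F u)) (F u) : ℂ) - (δ : ℂ) * ((‖F u‖ : ℂ)) ^ 2) =
      (inner ℂ (S (F u)) (F u) : ℂ).re - δ * ‖F u‖ ^ 2 := by
      rw [← Complex.ofReal_pow, ← Complex.ofReal_mul]
      exact (Complex.sub_re _ _).trans (by rw [Complex.ofReal_re])
    have h6 := h5 ▸ h3
    exact sub_nonneg.1 h6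
  have hfin : FiniteDimensional ℂ (F : H →ₗ[ℂ] H).range :=
    finiteDimensional_of_trace_bound _ hδ0 (sum_meanOperator_le hη.isMean U w) _ hlow
  have hcomm : ∀ γ : Γ, Commute F (U (ofAdd γ) : H →L[ℂ] H) := fun γ =>
    (meanOperator_commute hη U w γ).cfc_real f
  obtain ⟨e, he, he0, c, hc⟩ := exists_common_eigenvector
    (fun γ : Γ => ((U (ofAdd γ) : H →L[ℂ] H) : H →ₗ[ℂ] H))
    (fun i j => by
      ext x
      change U (ofAdd i) (U (ofAdd j) x) = U (ofAdd j) (U (ofAdd i) x)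
      rw [← unitary_add_apply, ← unitary_add_apply, add_comm]) _ (F : H →ₗ[ℂ] H).range rfl
    (fun h => hF0 (ContinuousLinearMap.coe_injective (LinearMap.range_eq_bot.1 h)))
    (by
      rintro γ _ ⟨u, rfl⟩
      exact ⟨U (ofAdd γ) u, congrArg (fun T : H →L[ℂ] H => T u) (hcomm γ)⟩)
  have hzero : coeffMul U e w w e = 0 := by
    refine BddFun.ext' fun γ => ?_
    have h7 : inner ℂ e (U (ofAdd γ) w) = (0 : ℂ) := by
      have := inner_unitary_left U (-γ) e w
      rw [neg_neg] at this
      rw [← this, show U (ofAdd (-γ)) e = c (-γ) • e from hc (-γ), inner_smul_left, hw e c hc,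
        mul_zero]
    rw [coeffMul_apply, h7, zero_mul]; rfl
  have h8 := hlow e he
  rw [hSdef, inner_meanOperator, hzero, map_zero, Complex.zero_re] at h8
  have : 0 < ‖e‖ := norm_pos_iff.2 he0
  have : 0 < δ * ‖e‖ ^ 2 := by positivity
  linarith

/-- A vector orthogonal to all common eigenvectors of a unitary action has matrix coefficients
which are negligible for every FS-mean. -/
theorem IsFSMean.map_mul_matrixCoeff_eq_zero (hη : IsFSMean η)
    (U : Multiplicative Γ →* (H ≃ₗᵢ[ℂ] H)) (w : H)
    (hw : ∀ (e : H) (c : Γ → ℂ), (∀ γ, U (ofAdd γ) e = c γ • e) → inner ℂ e w = (0 : ℂ))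
    (g : BddFun Γ) (v : H) : η (g * matrixCoeff U v w) = 0 := by
  refine hη.isMean.map_mul_eq_zero ?_ g
  have h := inner_meanOperator hη.isMean U w v v
  rw [meanOperator_eq_zero hη U w hw, zero_apply, inner_zero_left] at h
  rw [h, coeffMul]
  congr 1
  exact BddFun.ext' fun γ => by simp [mul_comm]

end Unitary

/-! ### The `L²`-space of a mean -/

namespace BddFun

variable {Γ : Type u} [AddCommGroup Γ]

/-- A character as a bounded function. -/
noncomputable def char (χ : AddChar Γ Circle) : BddFun Γ :=
  ofBound (fun x => (χ x : ℂ)) 1 fun x => (Circle.norm_coe (χ x)).le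

@[simp] theorem char_apply (χ : AddChar Γ Circle) (x : Γ) : char χ x = (χ x : ℂ) := rfl

theorem star_char_mul_char (χ : AddChar Γ Circle) : star (char χ) * char χ = 1 :=
  ext' fun x => by
    rw [mul_apply', star_apply', char_apply, one_apply', Complex.star_def, Complex.conj_mul', Circle.norm_coe]
    simp

end BddFun

namespace IsMean

variable {Γ : Type u} {m : BddFun Γ →ₗ[ℂ] ℂ}

/-- `ℓ^∞(Γ)` with the inner product `m(f̄ g)`. -/
@[nolint unusedArguments]
def PreL2 (_ : IsMean m) : Type u := BddFun Γ

variable (hm : IsMean m)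

noncomputable instance : AddCommGroup hm.PreL2 := inferInstanceAs (AddCommGroup (BddFun Γ))

noncomputable instance : Module ℂ hm.PreL2 := inferInstanceAs (Module ℂ (BddFun Γ))

/-- The identification of `ℓ^∞(Γ)` with the pre-Hilbert space of a mean. -/
noncomputable def toPreL2 : BddFun Γ ≃ₗ[ℂ] hm.PreL2 := LinearEquiv.refl ℂ (BddFun Γ)

/-- The semi-inner product `m(f̄ g)`. -/
noncomputable abbrev preL2Core : PreInnerProductSpace.Core ℂ hm.PreL2 where
  inner a b := m (star (hm.toPreL2.symm a) * hm.toPreL2.symm b)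
  conj_inner_symm a b := by
    rw [starRingEnd_apply, ← hm.map_star, BddFun.star_star_mul]
  re_inner_nonneg a :=
    (Complex.nonneg_iff.1 (hm.nonneg (star (hm.toPreL2.symm a) * hm.toPreL2.symm a)
      fun x => star_mul_self_nonneg (hm.toPreL2.symm a x))).1
  add_left a b c := by rw [map_add, star_add, add_mul, map_add]
  smul_left a b r := by rw [map_smul, star_smul, smul_mul_assoc, map_smul]; rfl

noncomputable instance : SeminormedAddCommGroup hm.PreL2 :=
  InnerProductSpace.Core.toSeminormedAddCommGroup (c := hm.preL2Core)

noncomputable instance : InnerProductSpace ℂ hm.PreL2 :=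
  InnerProductSpace.ofCore hm.preL2Core

/-- The Hilbert space `L²(m)` of a mean. -/
abbrev L2 : Type u := UniformSpace.Completion hm.PreL2

/-- The class of a bounded function in `L²(m)`. -/
noncomputable def toL2 : BddFun Γ →ₗ[ℂ] hm.L2 :=
  (UniformSpace.Completion.toComplL : hm.PreL2 →L[ℂ] hm.L2).toLinearMap ∘ₗ hm.toPreL2.toLinearMap

theorem toL2_apply (f : BddFun Γ) : hm.toL2 f = ((hm.toPreL2 f : hm.PreL2) : hm.L2) := rfl

theorem inner_toPreL2 (f g : BddFun Γ) :
    inner ℂ (hm.toPreL2 f) (hm.toPreL2 g) = m (star f * g) := rfl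

theorem inner_toL2 (f g : BddFun Γ) : inner ℂ (hm.toL2 f) (hm.toL2 g) = m (star f * g) := by
  rw [toL2_apply, toL2_apply, UniformSpace.Completion.inner_coe, inner_toPreL2]

theorem denseRange_toL2 : DenseRange hm.toL2 :=
  UniformSpace.Completion.denseRange_coe.comp hm.toPreL2.surjective.denseRange
    (UniformSpace.Completion.continuous_coe _)

/-- A linear bijection of `ℓ^∞(Γ)` preserving the inner product, as an isometry. -/
noncomputable def preL2Equiv (e : BddFun Γ ≃ₗ[ℂ] BddFun Γ)
    (he : ∀ f, m (star (e f) * e f) = m (star f * f)) : hm.PreL2 ≃ₗᵢ[ℂ] hm.PreL2 where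
  toLinearEquiv := (hm.toPreL2.symm.trans e).trans hm.toPreL2
  norm_map' f := by
    rw [@norm_eq_sqrt_re_inner ℂ, @norm_eq_sqrt_re_inner ℂ]
    exact congrArg (fun z : ℂ => √ z.re) (he (hm.toPreL2.symm f))

variable [AddCommGroup Γ]

/-- Multiplication by a character, as a linear bijection of `ℓ^∞(Γ)`. -/
noncomputable def _root_.BddFun.charMul (χ : AddChar Γ Circle) : BddFun Γ ≃ₗ[ℂ] BddFun Γ where
  toFun f := BddFun.char χ * f
  invFun f := star (BddFun.char χ) * f
  map_add' f g := mul_add _ f g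
  map_smul' c f := mul_smul_comm c _ f
  left_inv f := by
    change star (BddFun.char χ) * (BddFun.char χ * f) = f
    rw [← mul_assoc, BddFun.star_char_mul_char, one_mul]
  right_inv f := by
    change BddFun.char χ * (star (BddFun.char χ) * f) = f
    rw [← mul_assoc, mul_comm (BddFun.char χ), BddFun.star_char_mul_char, one_mul]

/-- Multiplication by a character on `L²(m)`. -/
noncomputable def charMul (χ : AddChar Γ Circle) : hm.L2 ≃ₗᵢ[ℂ] hm.L2 :=
  (hm.preL2Equiv (BddFun.charMul χ) fun f => by
    congr 1
    change star (BddFun.char χ * f) * (BddFun.char χ * f) = star f * f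
    refine BddFun.ext' fun x => ?_
    have := congrArg (fun g : BddFun Γ => g x) (BddFun.star_char_mul_char χ)
    simp only [BddFun.mul_apply', BddFun.star_apply', star_mul', BddFun.one_apply'] at this ⊢
    linear_combination (star (f x) * f x) * this).completion

theorem charMul_toL2 (χ : AddChar Γ Circle) (f : BddFun Γ) :
    hm.charMul χ (hm.toL2 f) = hm.toL2 (BddFun.char χ * f) :=
  LinearIsometryEquiv.completion_coe _ _

end IsMean

/-- Translation as a linear bijection of `ℓ^∞(Γ)`. -/
noncomputable def BddFun.translateEquiv {Γ : Type u} [AddCommGroup Γ] (γ : Γ) :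
    BddFun Γ ≃ₗ[ℂ] BddFun Γ where
  toFun f := f.translate γ
  invFun f := f.translate (-γ)
  map_add' f g := rfl
  map_smul' c f := rfl
  left_inv f := BddFun.ext' fun x => by simp
  right_inv f := BddFun.ext' fun x => by simp

/-! ### Translation on `L²(ν)`, ergodicity and eigenvectors -/

section Invariant

open Multiplicative

variable {Γ : Type u} [AddCommGroup Γ] {ν : BddFun Γ →ₗ[ℂ] ℂ}

/-- The translation action on `L²(ν)` before completion. -/
noncomputable def preTranslation (hm : IsMean ν) (hinv : ∀ (γ : Γ) (f : BddFun Γ), ν (f.translate γ) = ν f) :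
    Multiplicative Γ →* (hm.PreL2 ≃ₗᵢ[ℂ] hm.PreL2) where
  toFun γ := hm.preL2Equiv (BddFun.translateEquiv (toAdd γ)) fun f =>
    hinv (toAdd γ) (star f * f)
  map_one' := by
    ext f
    refine BddFun.ext' fun x => ?_
    change hm.toPreL2.symm f (x - 0) = hm.toPreL2.symm f x
    rw [sub_zero]
  map_mul' a b := by
    ext f
    refine BddFun.ext' fun x => ?_
    change hm.toPreL2.symm f (x - (toAdd a + toAdd b)) =
      hm.toPreL2.symm f (x - toAdd a - toAdd b)
    rw [sub_sub]

/-- The translation action on `L²(ν)`. -/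
noncomputable def translation (hm : IsMean ν) (hinv : ∀ (γ : Γ) (f : BddFun Γ), ν (f.translate γ) = ν f) :
    Multiplicative Γ →* (hm.L2 ≃ₗᵢ[ℂ] hm.L2) :=
  completionAction (preTranslation hm hinv)

theorem translation_toL2 (hm : IsMean ν) (hinv : ∀ (γ : Γ) (f : BddFun Γ), ν (f.translate γ) = ν f) (γ : Γ) (f : BddFun Γ) :
    translation hm hinv (ofAdd γ) (hm.toL2 f) = hm.toL2 (f.translate γ) :=
  completionAction_coe _ _ _

theorem matrixCoeff_translation (hm : IsMean ν) (hinv : ∀ (γ : Γ) (f : BddFun Γ), ν (f.translate γ) = ν f) (f g : BddFun Γ) (γ : Γ) :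
    matrixCoeff (translation hm hinv) (hm.toL2 f) (hm.toL2 g) γ = ν (star f * g.translate γ) := by
  rw [matrixCoeff_apply, translation_toL2, IsMean.inner_toL2]

theorem BddFun.translate_char_mul (χ : AddChar Γ Circle) (γ : Γ) (f : BddFun Γ) :
    (char χ * f).translate γ = (((χ γ)⁻¹ : Circle) : ℂ) • (char χ * f.translate γ) :=
  ext' fun x => by
    rw [translate_apply, mul_apply', smul_apply', mul_apply', translate_apply, char_apply,
      char_apply, AddChar.map_sub_eq_div, div_eq_mul_inv, Circle.coe_mul]
    ring

/-- The Weyl commutation relation. With it, multiplication by a suitable character turns a common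
eigenvector into an invariant vector. -/
theorem translation_charMul (hm : IsMean ν) (hinv : ∀ (γ : Γ) (f : BddFun Γ), ν (f.translate γ) = ν f)
    (χ : AddChar Γ Circle) (γ : Γ) (x : hm.L2) :
    translation hm hinv (ofAdd γ) (hm.charMul χ x) =
      (((χ γ)⁻¹ : Circle) : ℂ) • hm.charMul χ (translation hm hinv (ofAdd γ) x) := by
  generalize hA : translation hm hinv (ofAdd γ) = A
  have h : ∀ y : hm.L2, A (hm.charMul χ y) =
      (((χ γ)⁻¹ : Circle) : ℂ) • hm.charMul χ (A y) := by
    refine fun y => hm.denseRange_toL2.induction_on y (isClosed_eq ?_ ?_) fun f => ?_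
    · exact A.continuous.comp (hm.charMul χ).continuous
    · exact (continuous_const_smul (((χ γ)⁻¹ : Circle) : ℂ)).comp
        ((hm.charMul χ).continuous.comp A.continuous)
    · rw [IsMean.charMul_toL2, ← hA, translation_toL2, translation_toL2, IsMean.charMul_toL2,
        ← map_smul, BddFun.translate_char_mul]
  exact h x

/-- An extreme invariant mean has no nontrivial invariant perturbation. -/
theorem eq_zero_of_perturbation (hν : ν ∈ extremeInvariantMeans Γ) (D : BddFun Γ →ₗ[ℂ] ℂ)
    (h1 : D 1 = 0) (hinv : ∀ (γ : Γ) (f : BddFun Γ), D (f.translate γ) = D f)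
    (hpos : ∀ f : BddFun Γ, (∀ x, 0 ≤ f x) → 0 ≤ ν f + D f ∧ 0 ≤ ν f - D f) : D = 0 := by
  have hi := hν.1
  have hadd : ν + D ∈ invariantMeans Γ :=
    ⟨⟨by simp [hi.1.map_one, h1], fun f hf => (hpos f hf).1⟩, fun γ f => by
      simp [hi.2, hinv]⟩
  have hsub : ν - D ∈ invariantMeans Γ :=
    ⟨⟨by simp [hi.1.map_one, h1], fun f hf => (hpos f hf).2⟩, fun γ f => by
      simp [hi.2, hinv]⟩
  have := hν.2 hadd hsub ⟨1 / 2, 1 / 2, by norm_num, by norm_num, by norm_num, by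
    rw [← smul_add, add_add_sub_cancel, ← two_smul ℝ ν, smul_smul]
    norm_num⟩
  simpa using this

variable {η : BddFun Γ →ₗ[ℂ] ℂ}

/-- The functional `L g = η(γ ↦ ν(f · g_γ))` is translation invariant and satisfies `-Cν ≤ L ≤ Cν`
on nonnegative functions, so extremality forces `L = ν(f) ν`. The FS property evaluates `L g` as
`⟨f, P g⟩`. -/
theorem inner_starProjection_of_star_eq (hm : IsMean ν)
    (hinv : ∀ (γ : Γ) (f : BddFun Γ), ν (f.translate γ) = ν f)
    (hν : ν ∈ extremeInvariantMeans Γ) (hη : IsFSMean η) (f g : BddFun Γ) (hf : star f = f) :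
    inner ℂ (hm.toL2 f)
      ((invariantVectors (translation hm hinv)).starProjection (hm.toL2 g)) = ν f * ν g := by
  set U := translation hm hinv
  let L : BddFun Γ →ₗ[ℂ] ℂ :=
    { toFun := fun g => η (matrixCoeff U (hm.toL2 f) (hm.toL2 g))
      map_add' := fun a b => by rw [map_add, matrixCoeff_add_right, map_add]
      map_smul' := fun c a => by rw [map_smul, matrixCoeff_smul_right, map_smul]; rfl }
  have hL : ∀ g, L g = η (matrixCoeff U (hm.toL2 f) (hm.toL2 g)) := fun g => rfl
  have hL1 : L 1 = ν f := by
    have : matrixCoeff U (hm.toL2 f) (hm.toL2 1) = ν f • (1 : BddFun Γ) :=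
      BddFun.ext' fun γ => by
        rw [matrixCoeff_translation, hf]
        rw [BddFun.smul_apply', BddFun.one_apply', mul_one]
        congr 1
        exact BddFun.ext' fun x => by simp
    rw [hL, this, map_smul, hη.isMean.map_one, smul_eq_mul, mul_one]
  have hLinv : ∀ (γ : Γ) (g : BddFun Γ), L (g.translate γ) = L g := fun γ g => by
    rw [hL, hL, ← translation_toL2 hm hinv]
    exact hη.map_matrixCoeff_unitary U _ _ γ
  set C : ℝ := ‖f‖ + 1
  have hC : 0 < C := by positivity
  have hfr : ∀ x, ((f x).re : ℂ) = f x := fun x => Complex.conj_eq_iff_re.1 (by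
    conv_rhs => rw [← hf]
    rfl)
  have hfC : ∀ x, 0 ≤ (C : ℂ) + f x ∧ 0 ≤ (C : ℂ) - f x := fun x => by
    have h2 := BddFun.norm_apply_le f x
    have h3 := abs_le.1 (Complex.abs_re_le_norm (f x))
    rw [← hfr x, ← Complex.ofReal_add, ← Complex.ofReal_sub, Complex.zero_le_real,
      Complex.zero_le_real]
    constructor <;> simp only [C] <;> linarith
  have hLpos : ∀ g : BddFun Γ, (∀ x, 0 ≤ g x) → 0 ≤ C * ν g + L g ∧ 0 ≤ C * ν g - L g := by
    intro g hg
    have hc : ∀ γ, ((C * ν g : ℂ) • (1 : BddFun Γ)) γ = ν ((C : ℂ) • g.translate γ) := fun γ => by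
      rw [map_smul, hinv, BddFun.smul_apply', BddFun.one_apply', mul_one, smul_eq_mul]
    have e : C * ν g = η ((C * ν g : ℂ) • (1 : BddFun Γ)) := by
      rw [map_smul, hη.isMean.map_one, smul_eq_mul, mul_one]
    rw [hL, e]
    constructor
    · rw [← map_add]
      refine hη.isMean.nonneg _ fun γ => ?_
      rw [BddFun.add_apply', hc, matrixCoeff_translation, ← map_add, hf]
      refine hm.nonneg _ fun x => ?_
      have : ((C : ℂ) • g.translate γ + f * g.translate γ) x = (C + f x) * g (x - γ) := by
        rw [BddFun.add_apply', BddFun.smul_apply', BddFun.mul_apply', BddFun.translate_apply]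
        ring
      rw [this]
      exact mul_nonneg (hfC x).1 (hg _)
    · rw [← map_sub]
      refine hη.isMean.nonneg _ fun γ => ?_
      rw [BddFun.sub_apply', hc, matrixCoeff_translation, ← map_sub, hf]
      refine hm.nonneg _ fun x => ?_
      have : ((C : ℂ) • g.translate γ - f * g.translate γ) x = (C - f x) * g (x - γ) := by
        rw [BddFun.sub_apply', BddFun.smul_apply', BddFun.mul_apply', BddFun.translate_apply]
        ring
      rw [this]
      exact mul_nonneg (hfC x).2 (hg _)
  have hνf : 0 ≤ C + ν f ∧ 0 ≤ C - ν f := by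
    have := hLpos 1 fun x => by simp
    rwa [hL1, hm.map_one, mul_one] at this
  -- Subtracting `ν(f) ν` makes the perturbation kill `1`. The factor `1/(2C)` keeps `ν ± D`
  -- positive: `2C(ν ± D)` equals `(Cν ± L) + (C ∓ ν(f))ν`.
  have hD := eq_zero_of_perturbation hν (((1 / (2 * C) : ℝ) : ℂ) • (L - ν f • ν))
    (by simp [hL1, hm.map_one]) (fun γ g => by simp [hLinv, hinv])
    (fun g hg => by
      have h1 := hLpos g hg
      have h2 := hm.nonneg g hg
      have hCne : (C : ℂ) ≠ 0 := by exact_mod_cast hC.ne'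
      have hC' : 0 ≤ ((1 / (2 * C) : ℝ) : ℂ) := by
        rw [Complex.zero_le_real]; positivity
      have e1 : ν g + (((1 / (2 * C) : ℝ) : ℂ) • (L - ν f • ν)) g =
          ((1 / (2 * C) : ℝ) : ℂ) * ((C * ν g + L g) + (C - ν f) * ν g) := by
        simp
        field_simp
        ring
      have e2 : ν g - (((1 / (2 * C) : ℝ) : ℂ) • (L - ν f • ν)) g =
          ((1 / (2 * C) : ℝ) : ℂ) * ((C * ν g - L g) + (C + ν f) * ν g) := by
        simp
        field_simp
        ring
      rw [e1, e2]
      exact ⟨mul_nonneg hC' (add_nonneg h1.1 (mul_nonneg hνf.2 h2)),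
        mul_nonneg hC' (add_nonneg h1.2 (mul_nonneg hνf.1 h2))⟩)
  have hD' := LinearMap.congr_fun hD g
  have hne : ((1 / (2 * C) : ℝ) : ℂ) ≠ 0 := by
    rw [Complex.ofReal_ne_zero]; positivity
  rw [LinearMap.smul_apply, LinearMap.zero_apply, smul_eq_zero, or_iff_right hne,
    LinearMap.sub_apply, LinearMap.smul_apply, smul_eq_mul, sub_eq_zero, hL,
    hη.map_matrixCoeff] at hD'
  exact hD'

/-- Ergodicity: the vectors of `L²(ν)` invariant under translation are the constants. -/
theorem eq_smul_of_invariant (hm : IsMean ν)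
    (hinv : ∀ (γ : Γ) (f : BddFun Γ), ν (f.translate γ) = ν f)
    (hν : ν ∈ extremeInvariantMeans Γ) (hη : IsFSMean η) {x : hm.L2} (hx : x ∈ invariantVectors (translation hm hinv)) :
    ∃ c : ℂ, x = c • hm.toL2 1 := by
  set P := (invariantVectors (translation hm hinv)).starProjection
  have h1 : ∀ f g : BddFun Γ, inner ℂ (hm.toL2 f) (P (hm.toL2 g)) = ν (star f) * ν g := by
    intro f g
    obtain ⟨a, b, ha, hb, e, e'⟩ := f.exists_re_im
    have ha' := inner_starProjection_of_star_eq hm hinv hν hη a g ha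
    have hb' := inner_starProjection_of_star_eq hm hinv hν hη b g hb
    rw [e', e, map_add, map_smul hm.toL2, inner_add_left, inner_smul_left, ha', hb', map_sub,
      map_smul ν]
    simp
    ring
  have h2 : ∀ g : BddFun Γ, P (hm.toL2 g) = (inner ℂ (hm.toL2 1) (hm.toL2 g) : ℂ) • hm.toL2 1 := by
    intro g
    rw [IsMean.inner_toL2, star_one, one_mul]
    refine ext_inner_left ℂ fun y => hm.denseRange_toL2.induction_on y ?_ ?_
    · exact isClosed_eq (by fun_prop) (by fun_prop)
    · intro f
      rw [h1, inner_smul_right, IsMean.inner_toL2, mul_one, mul_comm]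
  have h3 : ∀ y : hm.L2, P y = (inner ℂ (hm.toL2 1) y : ℂ) • hm.toL2 1 := by
    refine fun y => hm.denseRange_toL2.induction_on y ?_ h2
    exact isClosed_eq (by fun_prop) (by fun_prop)
  exact ⟨_, (Submodule.starProjection_eq_self_iff.2 hx).symm.trans (h3 x)⟩

/-- A common eigenvector of the translations of `L²(ν)` is a multiple of a character. -/
theorem eq_smul_char_of_eigenvector (hm : IsMean ν)
    (hinv : ∀ (γ : Γ) (f : BddFun Γ), ν (f.translate γ) = ν f)
    (hν : ν ∈ extremeInvariantMeans Γ) (hη : IsFSMean η) {e : hm.L2} {c : Γ → ℂ} (he : ∀ γ, translation hm hinv (ofAdd γ) e = c γ • e) :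
    ∃ (a : ℂ) (χ : AddChar Γ Circle), e = a • hm.toL2 (BddFun.char χ) := by
  by_cases he0 : e = 0
  · exact ⟨0, 1, by rw [he0, zero_smul]⟩
  have hc1 : ∀ γ, ‖c γ‖ = 1 := fun γ => by
    have := congrArg norm (he γ)
    rw [LinearIsometryEquiv.norm_map, norm_smul] at this
    exact (mul_eq_right₀ (norm_ne_zero_iff.2 he0)).1 this.symm
  have hc0 : c 0 = 1 := by
    have := he 0
    rw [ofAdd_zero, map_one] at this
    have h' : (1 : ℂ) • e = c 0 • e := by rw [one_smul]; exact this
    exact (smul_left_injective ℂ he0 h').symm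
  have hcadd : ∀ γ δ, c (γ + δ) = c γ * c δ := fun γ δ => by
    have := he (γ + δ)
    rw [unitary_add_apply, he δ, map_smul, he γ, smul_smul] at this
    rw [mul_comm]
    exact (smul_left_injective ℂ he0 this).symm
  let d : Γ → Circle := fun γ => ⟨c γ, mem_sphere_zero_iff_norm.2 (hc1 γ)⟩
  have hd : ∀ γ, (d γ : ℂ) = c γ := fun γ => rfl
  -- The inverse appears because translating a character `χ` by `γ` multiplies it by `χ(γ)⁻¹`.
  -- Multiplying `e` by `χ⁻¹` then gives an invariant vector, that is, a constant.
  let χ : AddChar Γ Circle :=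
    { toFun := fun γ => (d γ)⁻¹
      map_zero_eq_one' := by
        rw [inv_eq_one]
        exact Circle.ext (by rw [hd, hc0, Circle.coe_one])
      map_add_eq_mul' := fun γ δ => by
        rw [← mul_inv]
        congr 1
        exact Circle.ext (by rw [Circle.coe_mul, hd, hd, hd, hcadd]) }
  have hχ : ∀ γ, χ γ = (d γ)⁻¹ := fun γ => rfl
  obtain ⟨a, ha⟩ := eq_smul_of_invariant hm hinv hν hη (x := hm.charMul χ⁻¹ e) (fun γ => by
    rw [translation_charMul, he, map_smul, smul_smul, AddChar.inv_apply', inv_inv, hχ, ← hd,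
      ← Circle.coe_mul, inv_mul_cancel, Circle.coe_one, one_smul])
  refine ⟨a, χ, (hm.charMul χ⁻¹).injective ?_⟩
  rw [ha, map_smul, IsMean.charMul_toL2]
  congr 2
  refine BddFun.ext' fun x => ?_
  rw [BddFun.mul_apply', BddFun.char_apply, BddFun.char_apply, BddFun.one_apply', ← Circle.coe_mul,
    AddChar.inv_apply', inv_mul_cancel, Circle.coe_one]

end Invariant

/-! ### Means and the Bohr compactification -/

theorem exists_urysohn {X : Type*} [TopologicalSpace X] [CompactSpace X] [T2Space X] {K U : Set X}
    (hK : IsCompact K) (hU : IsOpen U) (hKU : K ⊆ U) :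
    ∃ f : C(X, ℝ), (∀ x, 0 ≤ f x ∧ f x ≤ 1) ∧ (∀ x ∈ K, f x = 1) ∧ ∀ x ∉ U, f x = 0 := by
  obtain ⟨f, hf0, hf1, hf⟩ := exists_continuous_zero_one_of_isClosed hU.isClosed_compl hK.isClosed
    (Set.disjoint_compl_left_iff_subset.2 hKU)
  exact ⟨f, hf, fun x hx => hf1 hx, fun x hx => hf0 hx⟩

theorem integral_le_measureReal {X : Type*} [TopologicalSpace X] [CompactSpace X]
    [MeasurableSpace X] [BorelSpace X] {μ : Measure X} [IsFiniteMeasure μ] {U : Set X}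
    (hU : IsOpen U) {f : C(X, ℝ)} (hf : ∀ x, 0 ≤ f x ∧ f x ≤ 1) (hfU : ∀ x ∉ U, f x = 0) :
    ∫ x, f x ∂μ ≤ μ.real U := by
  rw [← integral_indicator_one hU.measurableSet]
  refine integral_mono
    (f.continuous.integrable_of_hasCompactSupport (HasCompactSupport.of_compactSpace f))
    ((integrable_const (1 : ℝ)).indicator hU.measurableSet) fun x => ?_
  by_cases hx : x ∈ U
  · simpa [hx] using (hf x).2
  · simp [hx, hfU x hx]

/-! ### Trigonometric polynomials on `bΓ` -/

namespace BohrCompactification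

variable {Γ : Type u} [AddCommGroup Γ]

instance : (haar Γ).IsAddHaarMeasure := inferInstanceAs (Measure.addHaarMeasure _).IsAddHaarMeasure

instance : (haar Γ).Regular := inferInstanceAs (Measure.addHaarMeasure _).Regular

theorem continuous_eval (χ : AddChar Γ Circle) :
    Continuous fun x : BohrCompactification Γ => eval x χ :=
  (continuous_apply χ).comp isEmbedding_eval.continuous

/-- The continuous extension of a character of `Γ` to the Bohr compactification. -/
noncomputable def charC (χ : AddChar Γ Circle) : C(BohrCompactification Γ, ℂ) where
  toFun x := (eval x χ : ℂ)
  continuous_toFun := continuous_induced_dom.comp (continuous_eval χ)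

theorem charC_apply (χ : AddChar Γ Circle) (x : BohrCompactification Γ) :
    charC χ x = (eval x χ : ℂ) := rfl

theorem charC_add (χ ψ : AddChar Γ Circle) : charC (χ + ψ) = charC χ * charC ψ := by
  ext x
  rw [ContinuousMap.mul_apply, charC_apply, charC_apply, charC_apply, ← Circle.coe_mul]
  congr 1
  exact AddChar.map_add_eq_mul (A := AddChar Γ Circle) x χ ψ

theorem charC_zero : charC (0 : AddChar Γ Circle) = 1 := by
  ext x
  rw [ContinuousMap.one_apply, charC_apply, ← Circle.coe_one]
  congr 1
  exact AddChar.map_zero_eq_one (A := AddChar Γ Circle) x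

theorem star_charC (χ : AddChar Γ Circle) : star (charC χ) = charC (-χ) := by
  ext x
  rw [ContinuousMap.star_apply, charC_apply, charC_apply, Complex.star_def,
    ← Circle.coe_inv_eq_conj]
  congr 1
  exact (AddChar.map_neg_eq_inv (A := AddChar Γ Circle) x χ).symm

/-- The star subalgebra of trigonometric polynomials. -/
noncomputable def trigSubalgebra (Γ : Type u) [AddCommGroup Γ] :
    StarSubalgebra ℂ C(BohrCompactification Γ, ℂ) where
  toSubalgebra := Algebra.adjoin ℂ (Set.range charC)
  star_mem' := by
    change Algebra.adjoin ℂ (Set.range charC) ≤ star (Algebra.adjoin ℂ (Set.range charC))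
    refine Algebra.adjoin_le ?_
    rintro _ ⟨χ, rfl⟩
    exact Algebra.subset_adjoin ⟨-χ, (star_charC χ).symm⟩

theorem trigSubalgebra_toSubmodule :
    Subalgebra.toSubmodule (trigSubalgebra Γ).toSubalgebra =
      Submodule.span ℂ (Set.range (charC (Γ := Γ))) := by
  apply Algebra.adjoin_eq_span_of_subset
  refine Set.Subset.trans ?_ Submodule.subset_span
  intro x hx
  refine Submonoid.closure_induction (fun _ => id) ⟨0, charC_zero⟩ ?_ hx
  rintro _ _ _ _ ⟨χ, rfl⟩ ⟨ψ, rfl⟩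
  exact ⟨χ + ψ, charC_add χ ψ⟩

/-- Trigonometric polynomials are dense. -/
theorem topologicalClosure_span_charC :
    (Submodule.span ℂ (Set.range (charC (Γ := Γ)))).topologicalClosure = ⊤ := by
  have h : (trigSubalgebra Γ).topologicalClosure = ⊤ := by
    refine ContinuousMap.starSubalgebra_topologicalClosure_eq_top_of_separatesPoints _ ?_
    intro x y hxy
    obtain ⟨χ, hχ⟩ := Function.ne_iff.1 (eval_injective.ne hxy)
    exact ⟨charC χ, ⟨charC χ, Algebra.subset_adjoin ⟨χ, rfl⟩, rfl⟩,
      fun h => hχ (Circle.ext h)⟩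
  rw [← trigSubalgebra_toSubmodule]
  exact congrArg (Subalgebra.toSubmodule <| StarSubalgebra.toSubalgebra ·) h

theorem integrable_continuous (f : C(BohrCompactification Γ, ℂ)) (μ : Measure (BohrCompactification Γ))
    [IsFiniteMeasure μ] : Integrable f μ :=
  f.continuous.integrable_of_hasCompactSupport (HasCompactSupport.of_compactSpace f)

theorem integral_charC {χ : AddChar Γ Circle} (hχ : χ ≠ 0) : ∫ x, charC χ x ∂(haar Γ) = 0 := by
  obtain ⟨γ, hγ⟩ : ∃ γ, χ γ ≠ 1 := by
    by_contra! h
    exact hχ (DFunLike.ext _ _ h)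
  have h1 : ∫ x, charC χ (ι γ + x) ∂(haar Γ) = ∫ x, charC χ x ∂(haar Γ) :=
    integral_add_left_eq_self (fun x => charC χ x) (ι γ)
  simp_rw [charC_apply, eval_add, Circle.coe_mul, eval_ι] at h1
  rw [integral_const_mul] at h1
  have h2 : ((χ γ : ℂ) - 1) * ∫ x, (eval x χ : ℂ) ∂(haar Γ) = 0 := by
    rw [sub_mul, h1, one_mul, sub_self]
  exact (mul_eq_zero.1 h2).resolve_left fun h => hγ (Circle.ext (sub_eq_zero.1 h))

end BohrCompactification

namespace BddFun

open BohrCompactification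

variable {Γ : Type u} [AddCommGroup Γ]

/-- The pullback of a continuous function on the Bohr compactification. -/
noncomputable def pull : C(BohrCompactification Γ, ℂ) →ₗ[ℂ] BddFun Γ where
  toFun f := ofBound (fun γ => f (ι γ)) ‖f‖ fun _ => f.norm_coe_le_norm _
  map_add' _ _ := rfl
  map_smul' _ _ := rfl

@[simp] theorem pull_apply (f : C(BohrCompactification Γ, ℂ)) (γ : Γ) : pull f γ = f (ι γ) := rfl

theorem pull_charC (χ : AddChar Γ Circle) : pull (charC χ) = char χ := rfl

theorem norm_pull_le (f : C(BohrCompactification Γ, ℂ)) : ‖pull f‖ ≤ ‖f‖ :=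
  norm_le_of_forall (norm_nonneg f) fun _ => f.norm_coe_le_norm _

end BddFun

/-- A mean annihilating all nontrivial characters. -/
structure IsCharacterMean {Γ : Type u} [AddCommGroup Γ] (m : BddFun Γ →ₗ[ℂ] ℂ) : Prop where
  isMean : IsMean m
  map_char : ∀ χ : AddChar Γ Circle, χ ≠ 0 → m (BddFun.char χ) = 0

/-! ### Means as Haar measure on continuous functions, and densities of sets -/

section

open BohrCompactification

variable {Γ : Type u} [AddCommGroup Γ] {m : BddFun Γ →ₗ[ℂ] ℂ}

theorem isCharacterMean_of_invariant (hm : IsMean m)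
    (hinv : ∀ (γ : Γ) (f : BddFun Γ), m (f.translate γ) = m f) : IsCharacterMean m where
  isMean := hm
  map_char χ hχ := by
    obtain ⟨γ, hγ⟩ : ∃ γ, χ γ ≠ 1 := by
      by_contra! h
      exact hχ (DFunLike.ext _ _ h)
    have h := hinv γ (BddFun.char χ)
    rw [← mul_one (BddFun.char χ), BddFun.translate_char_mul] at h
    have e : (1 : BddFun Γ).translate γ = 1 := BddFun.ext' fun x => by simp
    rw [e, map_smul, mul_one, smul_eq_mul] at h
    have h2 : ((((χ γ)⁻¹ : Circle) : ℂ) - 1) * m (BddFun.char χ) = 0 := by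
      rw [sub_mul, h, one_mul, sub_self]
    exact (mul_eq_zero.1 h2).resolve_left fun h =>
      hγ (inv_eq_one.1 (Circle.ext (sub_eq_zero.1 h)))

/-- The invariant mean `ν` only supplies a Hilbert space in the right universe in which `χ` is a
matrix coefficient: the character `-χ` in `L²(ν)` is a unit eigenvector of translation with
eigenvalue `χ`. -/
theorem IsFSMean.isCharacterMean {ν : BddFun Γ →ₗ[ℂ] ℂ} (hm : IsMean ν)
    (hinv : ∀ (γ : Γ) (f : BddFun Γ), ν (f.translate γ) = ν f) (hη : IsFSMean m) :
    IsCharacterMean m where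
  isMean := hη.isMean
  map_char χ hχ := by
    have hchi : (-χ : AddChar Γ Circle) ≠ 0 := neg_ne_zero.2 hχ
    obtain ⟨γ, hγ⟩ : ∃ γ, (-χ) γ ≠ 1 := by
      by_contra! h
      exact hchi (DFunLike.ext _ _ h)
    have hU : ∀ γ, translation hm hinv (Multiplicative.ofAdd γ) (hm.toL2 (BddFun.char (-χ))) =
        (χ γ : ℂ) • hm.toL2 (BddFun.char (-χ)) := fun γ => by
      rw [translation_toL2, ← mul_one (BddFun.char (-χ)), BddFun.translate_char_mul, ← map_smul]
      congr 2
      rw [AddChar.neg_apply', inv_inv]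
    have h1 : BddFun.char χ = matrixCoeff (translation hm hinv) (hm.toL2 (BddFun.char (-χ)))
        (hm.toL2 (BddFun.char (-χ))) := BddFun.ext' fun γ => by
      rw [matrixCoeff_apply, hU, inner_smul_right, IsMean.inner_toL2, BddFun.star_char_mul_char,
        hm.map_one, mul_one, BddFun.char_apply]
    have h2 := hη.map_matrixCoeff_unitary (translation hm hinv) (hm.toL2 (BddFun.char (-χ)))
        (hm.toL2 (BddFun.char (-χ))) γ
    rw [hU, matrixCoeff_smul_right, ← h1, map_smul, smul_eq_mul] at h2
    have h3 : ((χ γ : ℂ) - 1) * m (BddFun.char χ) = 0 := by rw [sub_mul, h2, one_mul, sub_self]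
    refine (mul_eq_zero.1 h3).resolve_left fun h => hγ ?_
    rw [AddChar.neg_apply', inv_eq_one]
    exact Circle.ext (sub_eq_zero.1 h)

namespace IsCharacterMean

/-- Both sides are continuous and linear in `f` and agree on characters, whose span is dense. -/
theorem map_pull (hm : IsCharacterMean m) (f : C(BohrCompactification Γ, ℂ)) :
    m (BddFun.pull f) = ∫ x, f x ∂(haar Γ) := by
  let L : C(BohrCompactification Γ, ℂ) →ₗ[ℂ] ℂ := m ∘ₗ BddFun.pull
  have hL : Continuous L := (L.mkContinuous 1 fun f => by
    rw [one_mul]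
    exact (hm.isMean.norm_le _).trans (BddFun.norm_pull_le f)).continuous
  let R : C(BohrCompactification Γ, ℂ) →ₗ[ℂ] ℂ :=
    { toFun := fun f => ∫ x, f x ∂(haar Γ)
      map_add' := fun f g => integral_add (integrable_continuous f _) (integrable_continuous g _)
      map_smul' := fun c f => integral_const_mul c _ }
  have hR : Continuous R := (R.mkContinuous 1 fun f => by
    have h := norm_integral_le_of_norm_le_const (μ := haar Γ)
      (Filter.Eventually.of_forall fun x => f.norm_coe_le_norm x)
    simpa [R] using h).continuous
  have h : (⊤ : Submodule ℂ C(BohrCompactification Γ, ℂ)) ≤ LinearMap.ker (L - R) := by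
    rw [← topologicalClosure_span_charC]
    refine Submodule.topologicalClosure_minimal _ ?_ ?_
    · rw [Submodule.span_le]
      rintro _ ⟨χ, rfl⟩
      rw [SetLike.mem_coe, LinearMap.mem_ker, LinearMap.sub_apply, sub_eq_zero]
      change m (BddFun.char χ) = ∫ x, charC χ x ∂(haar Γ)
      by_cases hχ : χ = 0
      · rw [hχ, ← BddFun.pull_charC, charC_zero, show BddFun.pull (1 : C(BohrCompactification Γ, ℂ))
          = 1 from rfl, hm.isMean.map_one]
        simp
      · rw [hm.map_char χ hχ, integral_charC hχ]
    · exact isClosed_singleton.preimage (hL.sub hR)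
  exact sub_eq_zero.1 (LinearMap.mem_ker.1 (h (Submodule.mem_top (x := f))))

/-- A real continuous function as a complex one. -/
noncomputable def _root_.ContinuousMap.complexOfReal {X : Type*} [TopologicalSpace X] (f : C(X, ℝ)) :
    C(X, ℂ) where
  toFun x := (f x : ℂ)
  continuous_toFun := Complex.continuous_ofReal.comp f.continuous

@[simp] theorem _root_.ContinuousMap.complexOfReal_apply {X : Type*} [TopologicalSpace X]
    (f : C(X, ℝ)) (x : X) : f.complexOfReal x = (f x : ℂ) := rfl

/-- The values of a mean on a subset of `Γ` have a density with respect to Haar measure. -/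
theorem exists_density (hm : IsCharacterMean m) (A : Set Γ) :
    ∃ h : BohrCompactification Γ → ℝ, Measurable h ∧ (∀ x, 0 ≤ h x) ∧ (∀ x, h x ≤ 1) ∧
      ∀ f : C(BohrCompactification Γ, ℂ),
        m (BddFun.ind A * BddFun.pull f) = ∫ x, (h x : ℂ) * f x ∂(haar Γ) := by
  have hmono : ∀ f : C(BohrCompactification Γ, ℝ), (∀ x, 0 ≤ f x) →
      0 ≤ m (BddFun.ind A * BddFun.pull f.complexOfReal) := fun f hf =>
    hm.isMean.nonneg _ fun γ => mul_nonneg (BddFun.ind_nonneg A γ)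
      (Complex.zero_le_real.2 (hf _))
  have hreal : ∀ f : C(BohrCompactification Γ, ℝ),
      ((m (BddFun.ind A * BddFun.pull f.complexOfReal)).re : ℂ) =
        m (BddFun.ind A * BddFun.pull f.complexOfReal) := fun f =>
    Complex.conj_eq_iff_re.1 (by
      rw [starRingEnd_apply, ← hm.isMean.map_star]
      congr 1
      refine BddFun.ext' fun x => ?_
      rw [BddFun.star_apply', BddFun.mul_apply', star_mul', ← BddFun.star_apply', BddFun.star_ind]
      simp)
  let Λ₀ : CompactlySupportedContinuousMap (BohrCompactification Γ) ℝ →ₗ[ℝ] ℝ :=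
    { toFun := fun f => (m (BddFun.ind A * BddFun.pull f.toContinuousMap.complexOfReal)).re
      map_add' := fun f g => by
        rw [← Complex.add_re, ← map_add, ← mul_add, ← map_add]
        congr 4
        ext x
        simp
      map_smul' := fun c f => by
        have e : BddFun.ind A * BddFun.pull (c • f).toContinuousMap.complexOfReal =
            (c : ℂ) • (BddFun.ind A * BddFun.pull f.toContinuousMap.complexOfReal) :=
          BddFun.ext' fun x => by
            rw [BddFun.mul_apply', BddFun.smul_apply', BddFun.mul_apply', BddFun.pull_apply,
              BddFun.pull_apply]
            simp
            ring
        rw [e, map_smul, RingHom.id_apply, smul_eq_mul, smul_eq_mul, Complex.re_ofReal_mul] }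
  let Λ := PositiveLinearMap.mk₀ Λ₀ fun f hf =>
    (Complex.nonneg_iff.1 (hmono f.toContinuousMap hf)).1
  set ρ := RealRMK.rieszMeasure Λ
  have hρ : ∀ f : CompactlySupportedContinuousMap (BohrCompactification Γ) ℝ,
      ∫ x, f x ∂ρ = (m (BddFun.ind A * BddFun.pull f.toContinuousMap.complexOfReal)).re :=
    RealRMK.integral_rieszMeasure Λ
  -- For a Urysohn function `F` between `K` and an open `U`, `ρ K ≤ m(1_A F) ≤ m(F) = ∫ F ≤ μ(U)`;
  -- regularity then extends the domination to all measurable sets.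
  have hρK : ∀ K, IsCompact K → ρ K ≤ haar Γ K := by
    intro K hK
    rw [K.measure_eq_iInf_isOpen (haar Γ)]
    refine le_iInf₂ fun U hKU => le_iInf fun hU => ?_
    obtain ⟨f, hf, hfK, hfU⟩ := exists_urysohn hK hU hKU
    let F : CompactlySupportedContinuousMap (BohrCompactification Γ) ℝ :=
      ⟨f, HasCompactSupport.of_compactSpace f⟩
    refine (RealRMK.rieszMeasure_le_of_eq_one Λ (f := F) (fun x => (hf x).1) hK hfK).trans ?_
    have h1 : m (BddFun.ind A * BddFun.pull f.complexOfReal) ≤ m (BddFun.pull f.complexOfReal) :=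
      hm.isMean.mono fun γ => mul_le_of_le_one_left (Complex.zero_le_real.2 (hf _).1)
        (BddFun.ind_le_one A γ)
    rw [hm.map_pull] at h1
    simp only [ContinuousMap.complexOfReal_apply] at h1
    rw [integral_complex_ofReal] at h1
    have h2 : Λ F ≤ ∫ x, f x ∂(haar Γ) := (Complex.le_def.1 h1).1
    refine (ENNReal.ofReal_le_ofReal (h2.trans (integral_le_measureReal hU hf hfU))).trans ?_
    rw [ofReal_measureReal]
  have hρle : ρ ≤ haar Γ := by
    have hfin : IsFiniteMeasure ρ := ⟨(hρK _ isCompact_univ).trans_lt (measure_lt_top _ _)⟩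
    refine Measure.le_iff.2 fun s hs => ?_
    rw [hs.measure_eq_iSup_isCompact_of_ne_top (measure_ne_top ρ s)]
    exact iSup₂_le fun K hK => iSup_le fun hKc => (hρK K hKc).trans (measure_mono hK)
  have hfin : IsFiniteMeasure ρ := isFiniteMeasure_of_le _ hρle
  -- The truncation turns the almost everywhere bound by `1` into one valid everywhere.
  let h : BohrCompactification Γ → ℝ := fun x => min 1 (ρ.rnDeriv (haar Γ) x).toReal
  have hh : ∀ᵐ x ∂(haar Γ), (ρ.rnDeriv (haar Γ) x).toReal = h x := by
    filter_upwards [Measure.rnDeriv_le_one_of_le hρle] with x hx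
    refine (min_eq_right ?_).symm
    exact ENNReal.toReal_le_of_le_ofReal zero_le_one (by simpa using hx)
  have hhm : Measurable h := measurable_const.min (Measure.measurable_rnDeriv _ _).ennreal_toReal
  have hh0 : ∀ x, 0 ≤ h x := fun x => le_min zero_le_one ENNReal.toReal_nonneg
  have hh1 : ∀ x, h x ≤ 1 := fun x => min_le_left _ _
  have hR : ∀ f : C(BohrCompactification Γ, ℝ),
      m (BddFun.ind A * BddFun.pull f.complexOfReal) = ∫ x, (h x : ℂ) * f x ∂(haar Γ) := by
    intro f
    rw [← hreal, ← hρ ⟨f, HasCompactSupport.of_compactSpace f⟩]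
    have e : ∫ x, f x ∂ρ = ∫ x, h x * f x ∂(haar Γ) := by
      rw [← integral_rnDeriv_smul (Measure.absolutelyContinuous_of_le hρle)]
      refine integral_congr_ae ?_
      filter_upwards [hh] with x hx
      rw [hx, smul_eq_mul]
    refine (congrArg Complex.ofReal e).trans ?_
    rw [← integral_complex_ofReal]
    simp
  refine ⟨h, hhm, hh0, hh1, fun f => ?_⟩
  let a : C(BohrCompactification Γ, ℝ) := ⟨fun x => (f x).re, by fun_prop⟩
  let b : C(BohrCompactification Γ, ℝ) := ⟨fun x => (f x).im, by fun_prop⟩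
  have e : BddFun.ind A * BddFun.pull f = BddFun.ind A * BddFun.pull a.complexOfReal +
      Complex.I • (BddFun.ind A * BddFun.pull b.complexOfReal) := BddFun.ext' fun x => by
    change BddFun.ind A x * f (ι x) = BddFun.ind A x * ((f (ι x)).re : ℂ) +
      Complex.I * (BddFun.ind A x * ((f (ι x)).im : ℂ))
    linear_combination -(BddFun.ind A x) * Complex.re_add_im (f (ι x))
  have hint : ∀ g : C(BohrCompactification Γ, ℝ), Integrable (fun x => (h x : ℂ) * g x) (haar Γ) :=
    fun g => (integrable_continuous g.complexOfReal _).bdd_mul (c := 1)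
      (Complex.measurable_ofReal.comp hhm).aestronglyMeasurable (Filter.Eventually.of_forall fun x => by
        rw [Complex.norm_real, Real.norm_eq_abs, abs_of_nonneg (hh0 x)]
        exact hh1 x)
  rw [e, map_add, map_smul, hR, hR, smul_eq_mul, ← integral_const_mul,
    ← integral_add (hint a) ((hint b).const_mul _)]
  refine integral_congr_ae (Filter.Eventually.of_forall fun x => ?_)
  change (h x : ℂ) * (f x).re + Complex.I * (h x * (f x).im) = h x * f x
  conv_rhs => rw [← Complex.re_add_im (f x)]
  ring

end IsCharacterMean

end

/-! ### Density points in compact abelian groups -/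

section Compact

open Filter

/-- A measurable set contains a `σ`-compact subset of the same measure. -/
theorem MeasurableSet.exists_isSigmaCompact_subset {X : Type*} [TopologicalSpace X] [T2Space X]
    [MeasurableSpace X] [BorelSpace X] {μ : Measure X} [IsFiniteMeasure μ] [μ.Regular] {T : Set X}
    (hT : MeasurableSet T) : ∃ T' ⊆ T, IsSigmaCompact T' ∧ μ (T \ T') = 0 := by
  have h : ∀ n : ℕ, ∃ K ⊆ T, IsCompact K ∧ μ (T \ K) < ((n : ℝ≥0∞) + 1)⁻¹ := fun n =>
    hT.exists_isCompact_sdiff_lt (measure_ne_top μ T) (by simp)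
  choose K hKT hK hlt using h
  refine ⟨⋃ n, K n, Set.iUnion_subset hKT, isSigmaCompact_iUnion_of_isCompact K hK, ?_⟩
  refine le_antisymm (ge_of_tendsto' ENNReal.tendsto_inv_nat_nhds_zero fun n => ?_) zero_le
  calc μ (T \ ⋃ n, K n) ≤ μ (T \ K n) :=
        measure_mono (Set.sdiff_subset_sdiff_right (Set.subset_iUnion K n))
    _ ≤ ((n : ℝ≥0∞) + 1)⁻¹ := (hlt n).le
    _ ≤ (n : ℝ≥0∞)⁻¹ := ENNReal.inv_le_inv.2 le_self_add

variable {G : Type*} [AddCommGroup G] [TopologicalSpace G] [IsTopologicalAddGroup G]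
  [CompactSpace G] [MeasurableSpace G] [BorelSpace G] {μ : Measure G}

/-- The group need not be second countable, so the Borel sets of `G × G` may exceed the product
σ-algebra and subtraction may fail to be measurable. Composites with continuous functions are still
product measurable, which is what Fubini requires. -/
theorem ContinuousMap.measurable_sub (f : C(G, ℝ)) :
    Measurable fun p : G × G => f (p.1 - p.2) :=
  HasCompactSupport.measurable_of_prod (f := fun p : G × G => f (p.1 - p.2)) (by fun_prop)
    (HasCompactSupport.of_compactSpace _)

theorem ContinuousMap.measurable_sub_swap (f : C(G, ℝ)) :
    Measurable fun p : G × G => f (p.2 - p.1) :=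
  HasCompactSupport.measurable_of_prod (f := fun p : G × G => f (p.2 - p.1)) (by fun_prop)
    (HasCompactSupport.of_compactSpace _)

variable [T2Space G]

/-- Up to null sets, measurable sets have product measurable preimages under subtraction. -/
theorem exists_ae_eq_measurableSet_sub [IsFiniteMeasure μ] [μ.Regular] {A : Set G}
    (hA : MeasurableSet A) : ∃ A₀ : Set G, MeasurableSet A₀ ∧ A₀ =ᵐ[μ] A ∧
      MeasurableSet {p : G × G | p.1 - p.2 ∈ A₀} := by
  -- A compact set is enlarged by a null set to a countable intersection of level sets `{f n = 1}`
  -- of continuous functions, whose preimages under subtraction are product measurable.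
  have hcpt : ∀ K : Set G, IsCompact K → ∃ K₀ : Set G, MeasurableSet K₀ ∧ K ⊆ K₀ ∧
      μ (K₀ \ K) = 0 ∧ MeasurableSet {p : G × G | p.1 - p.2 ∈ K₀} := by
    intro K hK
    have h : ∀ n : ℕ, ∃ f : C(G, ℝ), (∀ x ∈ K, f x = 1) ∧
        μ ({x | f x = 1} \ K) ≤ (n : ℝ≥0∞)⁻¹ := by
      intro n
      obtain ⟨U, hKU, hU, -, hlt⟩ := hK.measurableSet.exists_isOpen_sdiff_lt (measure_ne_top μ K)
        (ε := ((n : ℝ≥0∞) + 1)⁻¹) (by simp)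
      obtain ⟨f, -, hfK, hfU⟩ := exists_urysohn hK hU hKU
      refine ⟨f, hfK, ?_⟩
      calc μ ({x | f x = 1} \ K) ≤ μ (U \ K) := by
            refine measure_mono (Set.sdiff_subset_sdiff_left fun x hx => ?_)
            by_contra hxU
            have h1 : f x = 1 := hx
            rw [hfU x hxU] at h1
            exact zero_ne_one h1
        _ ≤ ((n : ℝ≥0∞) + 1)⁻¹ := hlt.le
        _ ≤ (n : ℝ≥0∞)⁻¹ := ENNReal.inv_le_inv.2 le_self_add
    choose f hfK hf using h
    refine ⟨⋂ n, {x | f n x = 1}, ?_, ?_, ?_, ?_⟩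
    · exact MeasurableSet.iInter fun n => (isClosed_singleton.preimage (f n).continuous).measurableSet
    · exact Set.subset_iInter fun n x hx => hfK n x hx
    · refine le_antisymm (ge_of_tendsto' ENNReal.tendsto_inv_nat_nhds_zero fun n => ?_) zero_le
      exact (measure_mono (Set.sdiff_subset_sdiff_left (Set.iInter_subset _ n))).trans (hf n)
    · simp only [Set.mem_iInter]
      rw [Set.ofPred_forall]
      exact MeasurableSet.iInter fun n => (f n).measurable_sub (measurableSet_singleton 1)
  obtain ⟨T, hTA, ⟨K, hK, hKT⟩, hT⟩ := hA.exists_isSigmaCompact_subset (μ := μ)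
  choose K₀ hm hsub hnull hprod using fun n => hcpt (K n) (hK n)
  refine ⟨⋃ n, K₀ n, MeasurableSet.iUnion hm, ?_, ?_⟩
  · refine Filter.EventuallyLE.antisymm ?_ ?_
    · rw [ae_le_set]
      refine measure_mono_null (t := ⋃ n, K₀ n \ K n) ?_ (measure_iUnion_null hnull)
      rintro x ⟨hx, hxA⟩
      obtain ⟨n, hn⟩ := Set.mem_iUnion.1 hx
      exact Set.mem_iUnion.2 ⟨n, hn, fun h => hxA (hTA (hKT ▸ Set.mem_iUnion.2 ⟨n, h⟩))⟩
    · rw [ae_le_set]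
      refine measure_mono_null (Set.sdiff_subset_sdiff_right ?_) hT
      rw [← hKT]
      exact Set.iUnion_mono hsub
  · simp only [Set.mem_iUnion]
    rw [Set.ofPred_exists]
    exact MeasurableSet.iUnion hprod

variable [μ.IsAddHaarMeasure]

/-- Small translations move a measurable set very little. -/
theorem eventually_measure_sub_notMem_lt {A : Set G} (hA : MeasurableSet A)
    {ε : ℝ≥0∞} (hε : ε ≠ 0) : ∀ᶠ v in 𝓝 (0 : G), μ {x | x ∈ A ∧ x - v ∉ A} < ε := by
  have hε2 : ε / 2 ≠ 0 := (ENNReal.half_pos hε).ne'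
  obtain ⟨K, hKA, hK, hlt⟩ := hA.exists_isCompact_sdiff_lt (μ := μ) (measure_ne_top μ A) hε2
  have h := (tendsto_measure_vadd_sdiff_isCompact_isClosed (μ := μ) hK hK.isClosed).eventually
    (gt_mem_nhds hε2.bot_lt)
  have h' : ∀ᶠ v in 𝓝 (0 : G), μ (((-v : G) +ᵥ K) \ K) < ε / 2 := by
    have ht : Tendsto (fun v : G => -v) (𝓝 0) (𝓝 0) := by
      simpa using (continuous_neg (G := G)).tendsto 0
    exact ht.eventually h
  filter_upwards [h'] with v hv
  -- Either `x` is in the small remainder `A \ K`, or `x ∈ K` and `x - v` has left `K`.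
  have hsub : {x | x ∈ A ∧ x - v ∉ A} ⊆ (A \ K) ∪ (fun x => x + -v) ⁻¹' (((-v : G) +ᵥ K) \ K) := by
    rintro x ⟨hx, hxv⟩
    by_cases hxK : x ∈ K
    · refine Or.inr ⟨?_, fun h => hxv (hKA (by rwa [sub_eq_add_neg]))⟩
      exact ⟨x, hxK, by simp [add_comm]⟩
    · exact Or.inl ⟨hx, hxK⟩
  calc μ {x | x ∈ A ∧ x - v ∉ A} ≤ μ (A \ K) + μ ((fun x => x + -v) ⁻¹' (((-v : G) +ᵥ K) \ K)) :=
        (measure_mono hsub).trans (measure_union_le _ _)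
    _ < ε / 2 + ε / 2 := by
        rw [measure_preimage_add_right]
        exact ENNReal.add_lt_add hlt hv
    _ = ε := ENNReal.add_halves ε

/-- Almost every point of a set is a density point with respect to suitable neighbourhoods. -/
theorem ae_eventually_measure_sub_notMem_lt {A : Set G} (hA : MeasurableSet A)
    (hA' : MeasurableSet {p : G × G | p.1 - p.2 ∈ A}) {V : ℕ → Set G} (hV : ∀ n, IsOpen (V n))
    (hV0 : ∀ n, (0 : G) ∈ V n)
    (hVA : ∀ n, ∀ v ∈ V n, μ {x | x ∈ A ∧ x - v ∉ A} < (2⁻¹ : ℝ≥0∞) ^ n) :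
    ∀ᵐ x ∂μ, x ∈ A → ∀ᶠ n in atTop, μ {v | v ∈ V n ∧ x - v ∉ A} < μ (V n) / 3 := by
  have hVpos : ∀ n, 0 < μ (V n) := fun n => (hV n).measure_pos μ ⟨0, hV0 n⟩
  let E : ℕ → Set (G × G) := fun n => {p | p.1 ∈ A ∧ p.2 ∈ V n ∧ p.1 - p.2 ∉ A}
  have hE : ∀ n, MeasurableSet (E n) := fun n =>
    (measurable_fst hA).inter ((measurable_snd (hV n).measurableSet).inter hA'.compl)
  have hEle : ∀ n, (μ.prod μ) (E n) ≤ (2⁻¹ : ℝ≥0∞) ^ n * μ (V n) := by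
    intro n
    rw [Measure.prod_apply_symm (hE n)]
    calc ∫⁻ v, μ ((fun x => (x, v)) ⁻¹' E n) ∂μ
        ≤ ∫⁻ v, (V n).indicator (fun _ => (2⁻¹ : ℝ≥0∞) ^ n) v ∂μ := by
          refine lintegral_mono fun v => ?_
          by_cases hv : v ∈ V n
          · rw [Set.indicator_of_mem hv]
            refine le_trans (measure_mono ?_) (hVA n v hv).le
            exact fun x hx => ⟨hx.1, hx.2.2⟩
          · have : (fun x => (x, v)) ⁻¹' E n = ∅ :=
              Set.eq_empty_of_forall_notMem fun x hx => hv hx.2.1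
            rw [this, measure_empty]
            exact zero_le
      _ = _ := lintegral_indicator_const (hV n).measurableSet _
  -- The bad points at scale `n`. By Fubini `E n` has measure at most `2⁻ⁿ μ(V n)`, so Markov bounds
  -- `N n` by `3 · 2⁻ⁿ`; these are summable and Borel–Cantelli applies.
  let N : ℕ → Set G := fun n => {x | μ (V n) / 3 ≤ μ (Prod.mk x ⁻¹' E n)}
  have hN : ∀ n, μ (N n) ≤ 3 * (2⁻¹ : ℝ≥0∞) ^ n := by
    intro n
    have h1 := mul_meas_ge_le_lintegral (μ := μ) (measurable_measure_prodMk_left (ν := μ) (hE n))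
      (μ (V n) / 3)
    rw [← Measure.prod_apply (hE n)] at h1
    have h2 := h1.trans (hEle n)
    have hne : μ (V n) / 3 ≠ 0 := (ENNReal.div_pos (hVpos n).ne' (by simp)).ne'
    have hnt : μ (V n) / 3 ≠ ∞ := ENNReal.div_ne_top (measure_ne_top μ _) (by simp)
    refine (ENNReal.mul_le_mul_iff_right hne hnt).1 (h2.trans (le_of_eq ?_))
    rw [mul_comm 3, ← mul_assoc, mul_comm (μ (V n) / 3), mul_assoc,
      ENNReal.div_mul_cancel (by simp) (by simp)]
  have hsum : (∑' n, μ (N n)) ≠ ∞ := by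
    refine ne_top_of_le_ne_top ?_ (ENNReal.tsum_le_tsum hN)
    rw [ENNReal.tsum_mul_left, ENNReal.tsum_geometric]
    refine ENNReal.mul_ne_top (by simp) ?_
    rw [ENNReal.one_sub_inv_two, inv_inv]
    simp
  filter_upwards [ae_eventually_notMem hsum] with x hx hxA
  filter_upwards [hx] with n hn
  have : μ (Prod.mk x ⁻¹' E n) < μ (V n) / 3 := not_le.1 hn
  refine lt_of_le_of_lt (measure_mono ?_) this
  exact fun v hv => ⟨hxA, hv.1, hv.2⟩

/-- Two measurable sets have `σ`-compact subsets of full measure such that every point of their sum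
has many representations. -/
theorem exists_isSigmaCompact_add [μ.Regular] {A B : Set G}
    (hA : MeasurableSet A) (hB : MeasurableSet B) :
    ∃ A' ⊆ A, ∃ B' ⊆ B, IsSigmaCompact A' ∧ IsSigmaCompact B' ∧ μ (A \ A') = 0 ∧ μ (B \ B') = 0 ∧
      ∀ x ∈ A', ∀ y ∈ B', 0 < μ {t | x + y - t ∈ A ∧ t ∈ B} := by
  obtain ⟨A₀, hA₀, hAe, hA₀'⟩ := exists_ae_eq_measurableSet_sub (μ := μ) hA
  obtain ⟨B₀, hB₀, hBe, hB₀'⟩ := exists_ae_eq_measurableSet_sub (μ := μ) hB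
  -- The same neighbourhoods serve both sets, and they are symmetric, so that `y - v` can be
  -- exchanged for `y + v`.
  have hV : ∀ n : ℕ, ∃ V : Set G, IsOpen V ∧ (0 : G) ∈ V ∧ (∀ v ∈ V, -v ∈ V) ∧
      (∀ v ∈ V, μ {x | x ∈ A₀ ∧ x - v ∉ A₀} < (2⁻¹ : ℝ≥0∞) ^ n) ∧
      (∀ v ∈ V, μ {x | x ∈ B₀ ∧ x - v ∉ B₀} < (2⁻¹ : ℝ≥0∞) ^ n) := by
    intro n
    have hne : (2⁻¹ : ℝ≥0∞) ^ n ≠ 0 := pow_ne_zero _ (by simp)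
    have h := (eventually_measure_sub_notMem_lt (μ := μ) hA₀ hne).and
      (eventually_measure_sub_notMem_lt (μ := μ) hB₀ hne)
    obtain ⟨W, hW, hWo, h0⟩ := eventually_nhds_iff.1 h
    refine ⟨W ∩ -W, hWo.inter hWo.neg, ⟨h0, by simpa using h0⟩,
      fun v hv => ⟨hv.2, by simpa using hv.1⟩, fun v hv => (hW v hv.1).1, fun v hv => (hW v hv.1).2⟩
  choose V hVo hV0 hVneg hVA hVB using hV
  have hVpos : ∀ n, 0 < μ (V n) := fun n => (hVo n).measure_pos μ ⟨0, hV0 n⟩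
  -- The exceptional null set is removed before passing to a σ-compact subset, so the density
  -- property holds at every point of `S'`.
  have key : ∀ {S S₀ : Set G}, MeasurableSet S → S₀ =ᵐ[μ] S →
      (∀ᵐ x ∂μ, x ∈ S₀ → ∀ᶠ n in atTop, μ {v | v ∈ V n ∧ x - v ∉ S₀} < μ (V n) / 3) →
      ∃ S' ⊆ S, IsSigmaCompact S' ∧ μ (S \ S') = 0 ∧
        ∀ x ∈ S', ∀ᶠ n in atTop, μ {v | v ∈ V n ∧ x - v ∉ S₀} < μ (V n) / 3 := by
    intro S S₀ hS hSe hae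
    have hae' : ∀ᵐ x ∂μ, x ∈ S → ∀ᶠ n in atTop, μ {v | v ∈ V n ∧ x - v ∉ S₀} < μ (V n) / 3 := by
      filter_upwards [hae, hSe.mem_iff] with x hx hx' hxS
      exact hx (hx'.2 hxS)
    obtain ⟨M, hM, hMm, hM0⟩ := exists_measurable_superset_of_null (ae_iff.1 hae')
    obtain ⟨S', hS', hcpt, hnull⟩ := (hS.diff hMm).exists_isSigmaCompact_subset (μ := μ)
    refine ⟨S', hS'.trans Set.sdiff_subset, hcpt, ?_, fun x hx => ?_⟩
    · refine measure_mono_null (t := ((S \ M) \ S') ∪ M) ?_ (measure_union_null hnull hM0)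
      rintro x ⟨hx, hx'⟩
      by_cases hxM : x ∈ M
      · exact Or.inr hxM
      · exact Or.inl ⟨⟨hx, hxM⟩, hx'⟩
    · by_contra hcon
      exact (hS' hx).2 (hM fun h => hcon (h (hS' hx).1))
  obtain ⟨A', hA'A, hA'c, hA'n, hA'd⟩ := key hA hAe
    (ae_eventually_measure_sub_notMem_lt hA₀ hA₀' hVo hV0 hVA)
  obtain ⟨B', hB'B, hB'c, hB'n, hB'd⟩ := key hB hBe
    (ae_eventually_measure_sub_notMem_lt hB₀ hB₀' hVo hV0 hVB)
  refine ⟨A', hA'A, B', hB'B, hA'c, hB'c, hA'n, hB'n, fun x hx y hy => ?_⟩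
  obtain ⟨n, hnA, hnB⟩ := ((hA'd x hx).and (hB'd y hy)).exists
  have hnB' : μ {v | v ∈ V n ∧ y + v ∉ B₀} < μ (V n) / 3 := by
    refine lt_of_eq_of_lt ?_ hnB
    rw [← Measure.measure_preimage_neg]
    congr 1
    ext v
    simp only [Set.mem_preimage, Set.mem_ofPred_eq, sub_eq_add_neg]
    exact and_congr_left fun _ => ⟨fun h => by simpa using hVneg n _ h, fun h => hVneg n v h⟩
  -- The `v` bad for `x` and those bad for `y` fill less than two thirds of `V n`; the others give
  -- representations `x + y = (x - v) + (y + v)`.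
  have hpos : 0 < μ {v | x - v ∈ A₀ ∧ y + v ∈ B₀} := by
    by_contra hcon
    have h0 : μ {v | x - v ∈ A₀ ∧ y + v ∈ B₀} = 0 := le_antisymm (not_lt.1 hcon) zero_le
    have hcover : V n ⊆ ({v | v ∈ V n ∧ x - v ∉ A₀} ∪ {v | v ∈ V n ∧ y + v ∉ B₀}) ∪
        {v | x - v ∈ A₀ ∧ y + v ∈ B₀} := by
      intro v hv
      by_cases h1 : x - v ∈ A₀
      · by_cases h2 : y + v ∈ B₀
        · exact Or.inr ⟨h1, h2⟩
        · exact Or.inl (Or.inr ⟨hv, h2⟩)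
      · exact Or.inl (Or.inl ⟨hv, h1⟩)
    have h1 : μ (V n) < μ (V n) / 3 + μ (V n) / 3 := by
      calc μ (V n) ≤ _ := (measure_mono hcover).trans (measure_union_le _ _)
        _ ≤ μ {v | v ∈ V n ∧ x - v ∉ A₀} + μ {v | v ∈ V n ∧ y + v ∉ B₀} := by
            rw [h0, add_zero]; exact measure_union_le _ _
        _ < _ := ENNReal.add_lt_add hnA hnB'
    have h2 := ENNReal.add_thirds (μ (V n))
    exact absurd (h1.trans_le (le_self_add.trans h2.le)) (lt_irrefl _)
  have hpos' : 0 < μ {t | x + y - t ∈ A₀ ∧ t ∈ B₀} := by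
    rw [← measure_preimage_add μ y]
    refine lt_of_lt_of_eq hpos (congrArg μ ?_)
    ext v
    simp only [Set.mem_preimage, Set.mem_ofPred_eq]
    rw [show x + y - (y + v) = x - v by abel]
  refine lt_of_lt_of_eq hpos' (measure_congr ?_)
  have h3 : ∀ᵐ t ∂μ, (x + y - t ∈ A₀ ↔ x + y - t ∈ A) :=
    (Measure.measurePreserving_sub_left μ (x + y)).quasiMeasurePreserving.ae hAe.mem_iff
  filter_upwards [h3, hBe.mem_iff] with t h3 h4
  exact propext (and_congr h3 h4)

end Compact

/-! ### The correlation identity -/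

section CauchySchwarz

variable {X : Type*} [MeasurableSpace X] {μ : Measure X}

theorem integral_abs_mul_abs_le_sqrt_mul_sqrt {f g : X → ℝ} (hf : MemLp f 2 μ) (hg : MemLp g 2 μ) :
    ∫ x, |f x| * |g x| ∂μ ≤ √(∫ x, f x ^ 2 ∂μ) * √(∫ x, g x ^ 2 ∂μ) := by
  have h := integral_mul_norm_le_Lp_mul_Lq (μ := μ) (f := f) (g := g)
    (Real.HolderConjugate.two_two) (by simpa using hf) (by simpa using hg)
  simpa [Real.sqrt_eq_rpow] using h

end CauchySchwarz

/-! ### Convolution on `bΓ` -/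

namespace BohrCompactification

variable {Γ : Type u} [AddCommGroup Γ]

theorem memLp_of_bounded {h : BohrCompactification Γ → ℝ} (hm : Measurable h) (h0 : ∀ x, 0 ≤ h x)
    (h1 : ∀ x, h x ≤ 1) : MemLp h 2 (haar Γ) :=
  MemLp.of_bound hm.aestronglyMeasurable 1 (Filter.Eventually.of_forall fun x => by
    rw [Real.norm_eq_abs, abs_of_nonneg (h0 x)]
    exact h1 x)

theorem memLp_continuous (f : C(BohrCompactification Γ, ℝ)) : MemLp f 2 (haar Γ) :=
  f.continuous.memLp_of_hasCompactSupport (HasCompactSupport.of_compactSpace f)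

theorem exists_continuous_integral_sq_le {h : BohrCompactification Γ → ℝ}
    (hh : MemLp h 2 (haar Γ)) {ε : ℝ} (hε : 0 < ε) :
    ∃ f : C(BohrCompactification Γ, ℝ), ∫ x, (f x - h x) ^ 2 ∂(haar Γ) ≤ ε := by
  obtain ⟨g, -, hg, hgc, -⟩ := MemLp.exists_hasCompactSupport_integral_rpow_sub_le (μ := haar Γ)
    (p := 2) (by norm_num) (by simpa using hh) hε
  refine ⟨⟨g, hgc⟩, le_of_eq_of_le ?_ hg⟩
  refine integral_congr_ae (Filter.Eventually.of_forall fun x => ?_)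
  simp only [ContinuousMap.coe_mk, Real.norm_eq_abs]
  rw [Real.rpow_two, sq_abs, ← neg_sub, neg_sq]

/-- The convolution `z ↦ ∫ f(z - y) g(y) dy`. -/
noncomputable def conv (f g : BohrCompactification Γ → ℝ) (z : BohrCompactification Γ) : ℝ :=
  ∫ y, g y * f (z - y) ∂(haar Γ)

theorem measurePreserving_sub_left (z : BohrCompactification Γ) :
    MeasurePreserving (fun y => z - y) (haar Γ) (haar Γ) :=
  Measure.measurePreserving_sub_left (haar Γ) z

theorem integrable_mul_sub {f g : BohrCompactification Γ → ℝ} (hf : MemLp f 2 (haar Γ))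
    (hg : Measurable g) (h0 : ∀ x, 0 ≤ g x) (h1 : ∀ x, g x ≤ 1) (z : BohrCompactification Γ) :
    Integrable (fun y => g y * f (z - y)) (haar Γ) :=
  (((measurePreserving_sub_left z).integrable_comp hf.1).2
    (hf.integrable (by norm_num))).bdd_mul (c := 1) hg.aestronglyMeasurable
    (Filter.Eventually.of_forall fun x => by
      rw [Real.norm_eq_abs, abs_of_nonneg (h0 x)]
      exact h1 x)

/-- Convolution with a function bounded by one contracts `L²` to the supremum norm. -/
theorem abs_conv_sub_conv_le {f f' g : BohrCompactification Γ → ℝ} (hf : MemLp f 2 (haar Γ))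
    (hf' : MemLp f' 2 (haar Γ)) (hg : Measurable g) (h0 : ∀ x, 0 ≤ g x) (h1 : ∀ x, g x ≤ 1)
    (z : BohrCompactification Γ) :
    |conv f g z - conv f' g z| ≤ √(∫ x, (f x - f' x) ^ 2 ∂(haar Γ)) := by
  have hd : MemLp (fun x => f x - f' x) 2 (haar Γ) := hf.sub hf'
  have hi : Integrable (fun y => |f (z - y) - f' (z - y)|) (haar Γ) :=
    (((measurePreserving_sub_left z).integrable_comp hd.1).2 (hd.integrable (by norm_num))).abs
  rw [conv, conv, ← integral_sub (integrable_mul_sub hf hg h0 h1 z)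
    (integrable_mul_sub hf' hg h0 h1 z)]
  calc |∫ y, g y * f (z - y) - g y * f' (z - y) ∂(haar Γ)|
      ≤ ∫ y, |f (z - y) - f' (z - y)| ∂(haar Γ) := by
        refine (abs_integral_le_integral_abs).trans (integral_mono_of_nonneg
          (Filter.Eventually.of_forall fun y => abs_nonneg _) hi
          (Filter.Eventually.of_forall fun y => ?_))
        simp only
        rw [← mul_sub, abs_mul, abs_of_nonneg (h0 y)]
        exact mul_le_of_le_one_left (abs_nonneg _) (h1 y)
    _ = ∫ y, |f y - f' y| ∂(haar Γ) :=
        integral_sub_left_eq_self (fun y => |f y - f' y|) (haar Γ) z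
    _ ≤ _ := by
        have := integral_abs_mul_abs_le_sqrt_mul_sqrt hd (memLp_const (1 : ℝ))
        simpa using this

/-- The map `y ↦ f(· - y)` into continuous functions. -/
noncomputable def translates (f : C(BohrCompactification Γ, ℂ)) :
    C(BohrCompactification Γ, C(BohrCompactification Γ, ℂ)) :=
  ContinuousMap.curry ⟨fun p => f (p.2 - p.1), by fun_prop⟩

theorem translates_apply (f : C(BohrCompactification Γ, ℂ)) (x y : BohrCompactification Γ) :
    translates f y x = f (x - y) := rfl

/-- The map `z ↦ f(z - ·)` is continuous into the supremum norm, on which integration against the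
bounded `g` is a continuous functional. -/
theorem continuous_conv_of_continuous (f : C(BohrCompactification Γ, ℝ))
    {g : BohrCompactification Γ → ℝ} (hg : Measurable g) (h0 : ∀ x, 0 ≤ g x) (h1 : ∀ x, g x ≤ 1) :
    Continuous (conv f g) := by
  let F : C(BohrCompactification Γ, C(BohrCompactification Γ, ℝ)) :=
    ContinuousMap.curry ⟨fun p => f (p.1 - p.2), by fun_prop⟩
  have hint : ∀ φ : C(BohrCompactification Γ, ℝ), Integrable (fun y => g y * φ y) (haar Γ) :=
    fun φ => ((memLp_continuous φ).integrable (by norm_num)).bdd_mul (c := 1)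
      hg.aestronglyMeasurable (Filter.Eventually.of_forall fun x => by
        rw [Real.norm_eq_abs, abs_of_nonneg (h0 x)]
        exact h1 x)
  let L : C(BohrCompactification Γ, ℝ) →ₗ[ℝ] ℝ :=
    { toFun := fun φ => ∫ y, g y * φ y ∂(haar Γ)
      map_add' := fun φ ψ => by
        rw [← integral_add (hint φ) (hint ψ)]
        simp [mul_add]
      map_smul' := fun c φ => by
        rw [RingHom.id_apply, smul_eq_mul, ← integral_const_mul]
        congr 1
        ext y
        simp
        ring }
  have hL : Continuous L := (L.mkContinuous 1 fun φ => by
    have h := norm_integral_le_of_norm_le_const (μ := haar Γ) (f := fun y => g y * φ y) (C := ‖φ‖)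
      (Filter.Eventually.of_forall fun y => by
        rw [norm_mul, Real.norm_eq_abs, abs_of_nonneg (h0 y)]
        exact (mul_le_of_le_one_left (norm_nonneg _) (h1 y)).trans (φ.norm_coe_le_norm y))
    simpa [L] using h).continuous
  exact hL.comp F.continuous

/-- The convolution of an `L²`-function and a bounded function is continuous. -/
theorem continuous_conv {f g : BohrCompactification Γ → ℝ} (hf : MemLp f 2 (haar Γ))
    (hg : Measurable g) (h0 : ∀ x, 0 ≤ g x) (h1 : ∀ x, g x ≤ 1) : Continuous (conv f g) := by
  refine continuous_of_uniform_approx_of_continuous fun u hu => ?_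
  obtain ⟨ε, hε, hεu⟩ := Metric.mem_uniformity_dist.1 hu
  obtain ⟨k, hk⟩ := exists_continuous_integral_sq_le hf (ε := (ε / 2) ^ 2) (by positivity)
  refine ⟨conv k g, continuous_conv_of_continuous k hg h0 h1, fun z => hεu ?_⟩
  rw [dist_comm, Real.dist_eq]
  refine (abs_conv_sub_conv_le (memLp_continuous k) hf hg h0 h1 z).trans_lt ?_
  refine (Real.sqrt_le_sqrt hk).trans_lt ?_
  rw [Real.sqrt_sq (by positivity)]
  linarith

theorem integrable_mul_mul_sub (f : C(BohrCompactification Γ, ℝ))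
    {g k : BohrCompactification Γ → ℝ} (hg : Measurable g) (hg0 : ∀ x, 0 ≤ g x) (hg1 : ∀ x, g x ≤ 1)
    (hk : Measurable k) (hk0 : ∀ x, 0 ≤ k x) (hk1 : ∀ x, k x ≤ 1) :
    Integrable (fun p : BohrCompactification Γ × BohrCompactification Γ =>
      g p.1 * (k p.2 * f (p.2 - p.1))) ((haar Γ).prod (haar Γ)) := by
  have h1 : Measurable fun p : BohrCompactification Γ × BohrCompactification Γ => f (p.2 - p.1) :=
    ContinuousMap.measurable_sub_swap f
  have h2 : Measurable fun p : BohrCompactification Γ × BohrCompactification Γ => g p.1 :=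
    hg.comp measurable_fst
  have h3 : Measurable fun p : BohrCompactification Γ × BohrCompactification Γ => k p.2 :=
    hk.comp measurable_snd
  refine Integrable.of_bound (h2.mul (h3.mul h1)).aestronglyMeasurable ‖f‖
    (Filter.Eventually.of_forall fun p => ?_)
  rw [norm_mul, norm_mul, Real.norm_eq_abs, Real.norm_eq_abs, abs_of_nonneg (hg0 _),
    abs_of_nonneg (hk0 _)]
  exact (mul_le_of_le_one_left (mul_nonneg (hk0 _) (norm_nonneg _)) (hg1 _)).trans
    ((mul_le_of_le_one_left (norm_nonneg _) (hk1 _)).trans (f.norm_coe_le_norm _))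

theorem integral_conv_swap (f : C(BohrCompactification Γ, ℝ))
    {g k : BohrCompactification Γ → ℝ} (hg : Measurable g) (hg0 : ∀ x, 0 ≤ g x) (hg1 : ∀ x, g x ≤ 1)
    (hk : Measurable k) (hk0 : ∀ x, 0 ≤ k x) (hk1 : ∀ x, k x ≤ 1) :
    ∫ y, g y * ∫ z, k z * f (z - y) ∂(haar Γ) ∂(haar Γ) = ∫ z, k z * conv f g z ∂(haar Γ) := by
  calc ∫ y, g y * ∫ z, k z * f (z - y) ∂(haar Γ) ∂(haar Γ)
      = ∫ y, ∫ z, g y * (k z * f (z - y)) ∂(haar Γ) ∂(haar Γ) :=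
        integral_congr_ae (Filter.Eventually.of_forall fun y =>
          (integral_const_mul (g y) fun z => k z * f (z - y)).symm)
    _ = ∫ z, ∫ y, g y * (k z * f (z - y)) ∂(haar Γ) ∂(haar Γ) :=
        integral_integral_swap (f := fun y z => g y * (k z * f (z - y)))
          (integrable_mul_mul_sub f hg hg0 hg1 hk hk0 hk1)
    _ = ∫ z, k z * conv f g z ∂(haar Γ) := by
        refine integral_congr_ae (Filter.Eventually.of_forall fun z => ?_)
        refine Eq.trans ?_ (integral_const_mul (k z) fun y => g y * f (z - y))
        refine integral_congr_ae (Filter.Eventually.of_forall fun y => ?_)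
        exact mul_left_comm _ _ _

end BohrCompactification

theorem IsMean.norm_toL2_sq {Γ : Type u} {ν : BddFun Γ →ₗ[ℂ] ℂ} (hm : IsMean ν) (f : BddFun Γ) :
    ‖hm.toL2 f‖ ^ 2 = (ν (star f * f)).re := by
  rw [← inner_toL2 hm, ← inner_self_eq_norm_sq (𝕜 := ℂ)]; rfl

/-! ### The span of the characters and the vanishing correlation -/

section

open BohrCompactification Multiplicative

variable {Γ : Type u} [AddCommGroup Γ] {ν η : BddFun Γ →ₗ[ℂ] ℂ}

/-- The closed span of the characters in `L²(m)`. -/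
noncomputable def IsMean.compactPart (hm : IsMean ν) : Submodule ℂ hm.L2 :=
  (Submodule.span ℂ (Set.range fun χ : AddChar Γ Circle => hm.toL2 (BddFun.char χ))).topologicalClosure

instance (hm : IsMean ν) : CompleteSpace hm.compactPart :=
  (Submodule.isClosed_topologicalClosure _).completeSpace_coe

theorem BddFun.pull_star_mul (f g : C(BohrCompactification Γ, ℂ)) :
    pull (star f * g) = star (pull f) * pull g := rfl

/-- On the compact part, `L²(ν)` only sees the density of a set. -/
theorem norm_compactPart_le (hm : IsMean ν) (hc : IsCharacterMean ν) (A : Set Γ)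
    {h : BohrCompactification Γ → ℝ} (hh : Measurable h) (h0 : ∀ x, 0 ≤ h x) (h1 : ∀ x, h x ≤ 1)
    (hd : ∀ f : C(BohrCompactification Γ, ℂ),
      ν (BddFun.ind A * BddFun.pull f) = ∫ x, (h x : ℂ) * f x ∂(haar Γ))
    (f : C(BohrCompactification Γ, ℝ)) :
    ‖hm.compactPart.starProjection (hm.toL2 (BddFun.pull f.complexOfReal - BddFun.ind A))‖ ≤
      √(∫ x, (f x - h x) ^ 2 ∂(haar Γ)) := by
  set d := BddFun.pull f.complexOfReal - BddFun.ind A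
  set ε := √(∫ x, (f x - h x) ^ 2 ∂(haar Γ))
  -- Against a continuous function, `1_A` integrates like its density `h`, so `d` acts as `f - h`
  -- and Cauchy–Schwarz on `bΓ` gives the bound.
  have hint : ∀ g : C(BohrCompactification Γ, ℂ),
      ‖inner ℂ (hm.toL2 (BddFun.pull g)) (hm.toL2 d)‖ ≤ ε * ‖hm.toL2 (BddFun.pull g)‖ := by
    intro g
    have e1 : inner ℂ (hm.toL2 (BddFun.pull g)) (hm.toL2 d) =
        ∫ x, star (g x) * ((f x - h x : ℝ) : ℂ) ∂(haar Γ) := by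
      have e : star (BddFun.pull g) * d = BddFun.pull (star g * f.complexOfReal) -
          BddFun.ind A * BddFun.pull (star g) := BddFun.ext' fun x => by
        simp only [d, BddFun.mul_apply', BddFun.sub_apply', BddFun.star_apply', BddFun.pull_apply,
          ContinuousMap.mul_apply, ContinuousMap.star_apply]
        ring
      rw [IsMean.inner_toL2, e, map_sub, hc.map_pull, hd, ← integral_sub]
      · refine integral_congr_ae (Filter.Eventually.of_forall fun x => ?_)
        simp only [ContinuousMap.mul_apply, ContinuousMap.star_apply,
          ContinuousMap.complexOfReal_apply, Complex.ofReal_sub]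
        ring
      · exact integrable_continuous _ _
      · exact (integrable_continuous (star g) _).bdd_mul (c := 1)
          (Complex.measurable_ofReal.comp hh).aestronglyMeasurable
          (Filter.Eventually.of_forall fun x => by
            rw [Complex.norm_real, Real.norm_eq_abs, abs_of_nonneg (h0 x)]
            exact h1 x)
    have e2 : ‖hm.toL2 (BddFun.pull g)‖ = √(∫ x, ‖g x‖ ^ 2 ∂(haar Γ)) := by
      have e3 : ν (star (BddFun.pull g) * BddFun.pull g) =
          ((∫ x, ‖g x‖ ^ 2 ∂(haar Γ) : ℝ) : ℂ) := by
        rw [← BddFun.pull_star_mul, hc.map_pull, ← integral_complex_ofReal]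
        refine integral_congr_ae (Filter.Eventually.of_forall fun x => ?_)
        simp only [ContinuousMap.mul_apply, ContinuousMap.star_apply]
        rw [Complex.star_def, Complex.conj_mul', Complex.ofReal_pow]
      rw [← Real.sqrt_sq (norm_nonneg (hm.toL2 (BddFun.pull g))), hm.norm_toL2_sq, e3,
        Complex.ofReal_re]
    rw [e1, e2]
    let gn : C(BohrCompactification Γ, ℝ) := ⟨fun x => ‖g x‖, by fun_prop⟩
    have h2 := integral_abs_mul_abs_le_sqrt_mul_sqrt (memLp_continuous gn)
      ((memLp_continuous f).sub (memLp_of_bounded hh h0 h1))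
    refine (norm_integral_le_integral_norm _).trans ?_
    rw [mul_comm]
    refine le_of_eq_of_le ?_ h2
    refine integral_congr_ae (Filter.Eventually.of_forall fun x => ?_)
    simp only [norm_mul, norm_star, Complex.norm_real, Real.norm_eq_abs, Pi.sub_apply]
    change _ = |‖g x‖| * _
    rw [abs_norm]
  have hspan : ∀ u ∈ hm.compactPart, ‖inner ℂ u (hm.toL2 d)‖ ≤ ε * ‖u‖ := by
    intro u hu
    have hcl : IsClosed {u : hm.L2 | ‖inner ℂ u (hm.toL2 d)‖ ≤ ε * ‖u‖} :=
      isClosed_le (by fun_prop) (by fun_prop)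
    refine closure_minimal (fun v hv => ?_) hcl hu
    have hle : Submodule.span ℂ (Set.range fun χ : AddChar Γ Circle => hm.toL2 (BddFun.char χ)) ≤
        LinearMap.range (hm.toL2 ∘ₗ BddFun.pull) := by
      rw [Submodule.span_le]
      rintro _ ⟨χ, rfl⟩
      exact ⟨charC χ, rfl⟩
    obtain ⟨g, rfl⟩ := hle hv
    exact hint g
  set w := hm.compactPart.starProjection (hm.toL2 d)
  have hw : w ∈ hm.compactPart := Submodule.starProjection_apply_mem _ _
  have h3 := hspan w hw
  -- Testing the bound against the projection `w` itself yields `‖w‖² ≤ ε ‖w‖`.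
  have h4 : inner ℂ w (hm.toL2 d) = ((‖w‖ ^ 2 : ℝ) : ℂ) := by
    have : inner ℂ w (hm.toL2 d - w) = (0 : ℂ) :=
      (Submodule.mem_orthogonal _ _).1 (Submodule.sub_starProjection_mem_orthogonal _) w hw
    rw [inner_sub_right, sub_eq_zero] at this
    rw [this, inner_self_eq_norm_sq_to_K]
    simp
  rw [h4, Complex.norm_real, Real.norm_eq_abs, abs_of_nonneg (by positivity), sq] at h3
  rcases (norm_nonneg w).eq_or_lt with h5 | h5
  · rw [← h5]; positivity
  · exact le_of_mul_le_mul_right h3 h5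

/-- If `1_C` and the translates of `1_A` by elements of `B` have disjoint supports, then the
density of `C` is orthogonal to the convolution of the densities of `A` and `B`. -/
theorem integral_mul_conv_eq_zero (hm : IsMean ν)
    (hinv : ∀ (γ : Γ) (f : BddFun Γ), ν (f.translate γ) = ν f)
    (hν : ν ∈ extremeInvariantMeans Γ) (hη : IsFSMean η) {A B C : Set Γ}
    (hdisj : ∀ b ∈ B, ∀ a ∈ A, a + b ∉ C)
    {f g k : BohrCompactification Γ → ℝ}
    (hf : Measurable f) (hf0 : ∀ x, 0 ≤ f x) (hf1 : ∀ x, f x ≤ 1)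
    (hfA : ∀ φ : C(BohrCompactification Γ, ℂ),
      ν (BddFun.ind A * BddFun.pull φ) = ∫ x, (f x : ℂ) * φ x ∂(haar Γ))
    (hg : Measurable g) (hg0 : ∀ x, 0 ≤ g x) (hg1 : ∀ x, g x ≤ 1)
    (hgB : ∀ φ : C(BohrCompactification Γ, ℂ),
      η (BddFun.ind B * BddFun.pull φ) = ∫ x, (g x : ℂ) * φ x ∂(haar Γ))
    (hk : Measurable k) (hk0 : ∀ x, 0 ≤ k x) (hk1 : ∀ x, k x ≤ 1)
    (hkC : ∀ φ : C(BohrCompactification Γ, ℂ),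
      ν (BddFun.ind C * BddFun.pull φ) = ∫ x, (k x : ℂ) * φ x ∂(haar Γ)) :
    ∫ z, k z * conv f g z ∂(haar Γ) = 0 := by
  have hc := isCharacterMean_of_invariant hm hinv
  have hf2 := memLp_of_bounded hf hf0 hf1
  set U := translation hm hinv
  have happrox : ∀ φ : C(BohrCompactification Γ, ℝ),
      |∫ z, k z * conv φ g z ∂(haar Γ)| ≤ √(∫ x, (φ x - f x) ^ 2 ∂(haar Γ)) := by
    intro φ
    -- The functional `T` vanishes at `1_A` by disjointness and equals the correlation integral at a
    -- continuous `φ`; the difference `φ - 1_A` matters only through its projection to the span of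
    -- characters.
    let T : hm.L2 → ℂ := fun w => η (BddFun.ind B * matrixCoeff U (hm.toL2 (BddFun.ind C)) w)
    have hTadd : ∀ w w', T (w + w') = T w + T w' := fun w w' => by
      simp only [T]
      rw [matrixCoeff_add_right, mul_add, map_add]
    have hTA : T (hm.toL2 (BddFun.ind A)) = 0 := by
      simp only [T]
      rw [show BddFun.ind B * matrixCoeff U (hm.toL2 (BddFun.ind C)) (hm.toL2 (BddFun.ind A)) = 0
        from ?_, map_zero]
      refine BddFun.ext' fun γ => ?_
      rw [BddFun.mul_apply', matrixCoeff_translation, BddFun.star_ind]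
      by_cases hγ : γ ∈ B
      · rw [show BddFun.ind C * (BddFun.ind A).translate γ = 0 from ?_, map_zero, mul_zero]
        · rfl
        · refine BddFun.ext' fun x => ?_
          rw [BddFun.mul_apply', BddFun.translate_apply]
          by_cases hx : x - γ ∈ A
          · have := hdisj γ hγ _ hx
            rw [sub_add_cancel] at this
            rw [BddFun.ind_of_notMem this, zero_mul]; rfl
          · rw [BddFun.ind_of_notMem hx, mul_zero]; rfl
      · rw [BddFun.ind_of_notMem hγ, zero_mul]; rfl
    have hTφ : T (hm.toL2 (BddFun.pull φ.complexOfReal)) =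
        ((∫ z, k z * conv φ g z ∂(haar Γ) : ℝ) : ℂ) := by
      have hL : Continuous fun ψ : C(BohrCompactification Γ, ℂ) =>
          ν (BddFun.ind C * BddFun.pull ψ) := by
        have h1 : Continuous (BddFun.pull : C(BohrCompactification Γ, ℂ) →ₗ[ℂ] BddFun Γ) :=
          (BddFun.pull.mkContinuous 1 fun f => by
            rw [one_mul]; exact BddFun.norm_pull_le f).continuous
        exact hm.continuous.comp (continuous_const.mul h1)
      -- The function `y ↦ ∫ k(z) φ(z - y) dz`, continuous on all of `bΓ`. The matrix coefficient is
      -- its restriction to `Γ`, so the density of `B` evaluates its mean.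
      let G : C(BohrCompactification Γ, ℂ) :=
        ⟨fun y => ν (BddFun.ind C * BddFun.pull (translates φ.complexOfReal y)),
          hL.comp (translates φ.complexOfReal).continuous⟩
      have hG : ∀ y, G y = ((∫ z, k z * φ (z - y) ∂(haar Γ) : ℝ) : ℂ) := fun y => by
        change ν _ = _
        rw [hkC, ← integral_complex_ofReal]
        refine integral_congr_ae (Filter.Eventually.of_forall fun z => ?_)
        simp [translates_apply]
      have e : matrixCoeff U (hm.toL2 (BddFun.ind C)) (hm.toL2 (BddFun.pull φ.complexOfReal)) =
          BddFun.pull G := BddFun.ext' fun γ => by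
        rw [matrixCoeff_translation, BddFun.star_ind]
        change _ = ν _
        congr 2
        refine BddFun.ext' fun x => ?_
        rw [BddFun.translate_apply, BddFun.pull_apply, BddFun.pull_apply, translates_apply, map_sub]
      simp only [T]
      rw [e, hgB, ← integral_conv_swap φ hg hg0 hg1 hk hk0 hk1, ← integral_complex_ofReal]
      refine integral_congr_ae (Filter.Eventually.of_forall fun y => ?_)
      simp only [hG, Complex.ofReal_mul]
    set d := hm.toL2 (BddFun.pull φ.complexOfReal - BddFun.ind A)
    set w := hm.compactPart.starProjection d
    have hTd : T (hm.toL2 (BddFun.pull φ.complexOfReal)) = T w := by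
      have e1 : hm.toL2 (BddFun.pull φ.complexOfReal) = hm.toL2 (BddFun.ind A) + d := by
        simp only [d]
        rw [map_sub, add_sub_cancel]
      have e2 : d = (d - w) + w := (sub_add_cancel d w).symm
      -- The common eigenvectors are multiples of characters, and `d - w` is orthogonal to these.
      have e3 : T (d - w) = 0 := by
        refine hη.map_mul_matrixCoeff_eq_zero U (d - w) (fun e c he => ?_) _ _
        obtain ⟨a, χ, rfl⟩ := eq_smul_char_of_eigenvector hm hinv hν hη he
        exact (Submodule.mem_orthogonal _ _).1 (Submodule.sub_starProjection_mem_orthogonal _) _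
          (Submodule.smul_mem _ _ (Submodule.le_topologicalClosure _
            (Submodule.subset_span ⟨χ, rfl⟩)))
      rw [e1, hTadd, hTA, zero_add, e2, hTadd, e3, zero_add]
    have hC1 : ‖hm.toL2 (BddFun.ind C)‖ ≤ 1 := by
      have h1 : ν (star (BddFun.ind C) * BddFun.ind C) ≤ ν 1 := hm.mono fun x => by
        by_cases hx : x ∈ C
        · rw [BddFun.mul_apply', BddFun.star_ind, BddFun.ind_of_mem hx]; simp
        · rw [BddFun.mul_apply', BddFun.star_ind, BddFun.ind_of_notMem hx]; simp
      rw [hm.map_one] at h1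
      have h2 := hm.norm_toL2_sq (BddFun.ind C)
      have h3 := (Complex.le_def.1 h1).1
      rw [← h2, Complex.one_re] at h3
      exact (sq_le_one_iff₀ (norm_nonneg _)).1 h3
    have hTw : ‖T w‖ ≤ ‖w‖ := by
      refine hη.isMean.norm_le_of_forall (norm_nonneg w) fun γ => ?_
      rw [BddFun.mul_apply', norm_mul]
      have h1 : ‖BddFun.ind B γ‖ ≤ 1 := by
        by_cases hγ : γ ∈ B
        · rw [BddFun.ind_of_mem hγ, norm_one]
        · rw [BddFun.ind_of_notMem hγ, norm_zero]; exact zero_le_one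
      calc _ ≤ 1 * (‖hm.toL2 (BddFun.ind C)‖ * ‖w‖) := by
            gcongr
            exact norm_matrixCoeff_le ..
        _ ≤ 1 * (1 * ‖w‖) := by gcongr
        _ = ‖w‖ := by ring
    have h5 := hTw.trans (norm_compactPart_le hm hc A hf hf0 hf1 hfA φ)
    rwa [← hTd, hTφ, Complex.norm_real, Real.norm_eq_abs] at h5
  have hki : ∀ {F : BohrCompactification Γ → ℝ}, Continuous F →
      Integrable (fun z => k z * F z) (haar Γ) := fun {F} hF =>
    (hF.integrable_of_hasCompactSupport (HasCompactSupport.of_compactSpace F)).bdd_mul (c := 1)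
      hk.aestronglyMeasurable (Filter.Eventually.of_forall fun x => by
        rw [Real.norm_eq_abs, abs_of_nonneg (hk0 x)]
        exact hk1 x)
  refine abs_nonpos_iff.1 (le_of_forall_pos_le_add fun ε hε => ?_)
  obtain ⟨φ, hφ⟩ := exists_continuous_integral_sq_le hf2 (ε := (ε / 2) ^ 2) (by positivity)
  have hφ' : √(∫ x, (φ x - f x) ^ 2 ∂(haar Γ)) ≤ ε / 2 := by
    rw [← Real.sqrt_sq (by positivity : 0 ≤ ε / 2)]
    exact Real.sqrt_le_sqrt hφ
  have hcφ := continuous_conv (memLp_continuous φ) hg hg0 hg1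
  have hcf := continuous_conv hf2 hg hg0 hg1
  have h6 : |∫ z, k z * conv φ g z ∂(haar Γ) - ∫ z, k z * conv f g z ∂(haar Γ)| ≤ ε / 2 := by
    rw [← integral_sub (hki hcφ) (hki hcf), ← Real.norm_eq_abs]
    have h7 := norm_integral_le_of_norm_le_const (μ := haar Γ) (C := ε / 2)
      (f := fun z => k z * conv φ g z - k z * conv f g z)
      (Filter.Eventually.of_forall fun z => by
        rw [← mul_sub, norm_mul, Real.norm_eq_abs, Real.norm_eq_abs, abs_of_nonneg (hk0 z)]
        exact (mul_le_of_le_one_left (abs_nonneg _) (hk1 z)).trans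
          ((abs_conv_sub_conv_le (memLp_continuous φ) hf2 hg hg0 hg1 z).trans hφ'))
    simpa using h7
  have h8 := (happrox φ).trans hφ'
  have h9 := abs_sub_abs_le_abs_sub (∫ z, k z * conv f g z ∂(haar Γ)) (∫ z, k z * conv φ g z ∂(haar Γ))
  rw [abs_sub_comm] at h9
  linarith

end

/-! ### Sumsets -/

theorem IsMean.meanOf_le {Γ : Type u} {m : BddFun Γ →ₗ[ℂ] ℂ} (hm : IsMean m) {A : Set Γ}
    {f : BddFun Γ} (h : ∀ x, BddFun.ind A x ≤ f x) : meanOf m A ≤ (m f).re :=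
  (Complex.le_def.1 (hm.mono h)).1

section

open BohrCompactification

variable {Γ : Type u} [AddCommGroup Γ] {m ν η : BddFun Γ →ₗ[ℂ] ℂ}

/-- The density tested against a real continuous function. -/
theorem re_map_ind_mul_pull {A : Set Γ} {h : BohrCompactification Γ → ℝ}
    (hd : ∀ f : C(BohrCompactification Γ, ℂ),
      m (BddFun.ind A * BddFun.pull f) = ∫ x, (h x : ℂ) * f x ∂(haar Γ))
    (f : C(BohrCompactification Γ, ℝ)) :
    (m (BddFun.ind A * BddFun.pull f.complexOfReal)).re = ∫ x, h x * f x ∂(haar Γ) := by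
  rw [hd, ← Complex.ofReal_re (∫ x, h x * f x ∂(haar Γ)), ← integral_complex_ofReal]
  simp

theorem integrable_mul_continuous {h : BohrCompactification Γ → ℝ} (hh : Measurable h)
    (h0 : ∀ x, 0 ≤ h x) (h1 : ∀ x, h x ≤ 1) (f : C(BohrCompactification Γ, ℝ)) :
    Integrable (fun x => h x * f x) (haar Γ) :=
  ((memLp_continuous f).integrable (by norm_num)).bdd_mul (c := 1) hh.aestronglyMeasurable
    (Filter.Eventually.of_forall fun x => by
      rw [Real.norm_eq_abs, abs_of_nonneg (h0 x)]
      exact h1 x)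

theorem measureReal_inter_eq_of_null {X : Type*} [MeasurableSpace X] {μ : Measure X} {S S' : Set X}
    (hS : S' ⊆ S) (hnull : μ (S \ S') = 0) (V : Set X) : μ.real (S' ∩ V) = μ.real (S ∩ V) := by
  refine measureReal_congr ?_
  have h1 : S' ≤ᵐ[μ] S := Filter.Eventually.of_forall hS
  exact (h1.antisymm (ae_le_set.2 hnull)).inter (Filter.EventuallyEq.refl _ _)

/-- A Urysohn function between `V` and a slightly larger open set dominates `1_V`, and the density
is at most `1`, so the integral is at most the measure of `{h > 0}` in that open set. -/
theorem meanOf_inter_le_of_isCompact (hm : IsMean m) {A : Set Γ} {h : BohrCompactification Γ → ℝ}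
    (hh : Measurable h) (h0 : ∀ x, 0 ≤ h x) (h1 : ∀ x, h x ≤ 1)
    (hd : ∀ f : C(BohrCompactification Γ, ℂ),
      m (BddFun.ind A * BddFun.pull f) = ∫ x, (h x : ℂ) * f x ∂(haar Γ))
    {V : Set (BohrCompactification Γ)} (hV : IsCompact V) :
    meanOf m (A ∩ ι ⁻¹' V) ≤ (haar Γ).real ({x | 0 < h x} ∩ V) := by
  have hS : MeasurableSet {x | 0 < h x} := measurableSet_lt measurable_const hh
  refine le_of_forall_pos_le_add fun ε hε => ?_
  obtain ⟨U, hVU, hU, -, hlt⟩ := hV.measurableSet.exists_isOpen_sdiff_lt (measure_ne_top (haar Γ) V)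
    (ε := ENNReal.ofReal ε) (by simpa using hε)
  obtain ⟨f, hf, hfV, hfU⟩ := exists_urysohn hV hU hVU
  have hle : meanOf m (A ∩ ι ⁻¹' V) ≤ ∫ x, h x * f x ∂(haar Γ) := by
    rw [← re_map_ind_mul_pull hd]
    refine hm.meanOf_le fun γ => ?_
    by_cases hγ : γ ∈ A ∩ ι ⁻¹' V
    · rw [BddFun.ind_of_mem hγ, BddFun.mul_apply', BddFun.ind_of_mem hγ.1, BddFun.pull_apply,
        ContinuousMap.complexOfReal_apply, hfV _ hγ.2]
      simp
    · rw [BddFun.ind_of_notMem hγ]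
      exact mul_nonneg (BddFun.ind_nonneg A γ) (Complex.zero_le_real.2 (hf _).1)
  have hle2 : ∫ x, h x * f x ∂(haar Γ) ≤ (haar Γ).real ({x | 0 < h x} ∩ U) := by
    rw [← integral_indicator_one (hS.inter hU.measurableSet)]
    refine integral_mono (integrable_mul_continuous hh h0 h1 f)
      ((integrable_const (1 : ℝ)).indicator (hS.inter hU.measurableSet)) fun x => ?_
    by_cases hx : x ∈ {x | 0 < h x} ∩ U
    · rw [Set.indicator_of_mem hx]
      exact mul_le_one₀ (h1 x) (hf x).1 (hf x).2
    · rw [Set.indicator_of_notMem hx]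
      refine le_of_eq ?_
      by_cases hxU : x ∈ U
      · rw [le_antisymm (not_lt.1 fun hpos => hx ⟨hpos, hxU⟩) (h0 x), zero_mul]
      · rw [hfU x hxU, mul_zero]
  have hle3 : (haar Γ).real ({x | 0 < h x} ∩ U) ≤
      (haar Γ).real ({x | 0 < h x} ∩ V) + (haar Γ).real (U \ V) := by
    refine (measureReal_mono (fun x hx => ?_)).trans (measureReal_union_le _ _)
    by_cases hxV : x ∈ V
    · exact Or.inl ⟨hx.1, hxV⟩
    · exact Or.inr ⟨hx.2, hxV⟩
  have hle4 : (haar Γ).real (U \ V) ≤ ε := ENNReal.toReal_le_of_le_ofReal hε.le hlt.le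
  linarith

/-- For clopen `V` the indicator is continuous, so the mean of `A ∩ V` is exactly `∫_V h`, which
vanishes precisely when `h = 0` almost everywhere on `V`. -/
theorem measureReal_inter_eq_zero_iff {A : Set Γ} {h : BohrCompactification Γ → ℝ}
    (hh : Measurable h) (h0 : ∀ x, 0 ≤ h x) (h1 : ∀ x, h x ≤ 1)
    (hd : ∀ f : C(BohrCompactification Γ, ℂ),
      m (BddFun.ind A * BddFun.pull f) = ∫ x, (h x : ℂ) * f x ∂(haar Γ))
    {V : Set (BohrCompactification Γ)} (hV : IsClopen V) :
    (haar Γ).real ({x | 0 < h x} ∩ V) = 0 ↔ meanOf m (A ∩ ι ⁻¹' V) = 0 := by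
  let f : C(BohrCompactification Γ, ℝ) :=
    ⟨V.indicator fun _ => 1, (hV.continuous_indicator continuous_const)⟩
  have hfV : ∀ x ∈ V, f x = 1 := fun x hx =>
    Set.indicator_of_mem hx fun _ => (1 : ℝ)
  have hfV' : ∀ x ∉ V, f x = 0 := fun x hx =>
    Set.indicator_of_notMem hx fun _ => (1 : ℝ)
  have hind : BddFun.ind (A ∩ ι ⁻¹' V) = BddFun.ind A * BddFun.pull f.complexOfReal := by
    refine BddFun.ext' fun γ => ?_
    rw [BddFun.mul_apply', BddFun.pull_apply, ContinuousMap.complexOfReal_apply]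
    by_cases hγ : ι γ ∈ V
    · rw [hfV _ hγ, Complex.ofReal_one, mul_one]
      by_cases hA : γ ∈ A
      · rw [BddFun.ind_of_mem hA, BddFun.ind_of_mem (show γ ∈ A ∩ ι ⁻¹' V from ⟨hA, hγ⟩)]
      · rw [BddFun.ind_of_notMem hA, BddFun.ind_of_notMem fun h => hA h.1]
    · rw [hfV' _ hγ, Complex.ofReal_zero, mul_zero, BddFun.ind_of_notMem fun h => hγ h.2]
  have hnn : 0 ≤ fun x => h x * f x := fun x => by
    by_cases hx : x ∈ V
    · simpa [hfV x hx] using h0 x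
    · simp [hfV' x hx]
  have hset : {x | 0 < h x} ∩ V = Function.support fun x => h x * f x := by
    ext x
    rw [Function.mem_support]
    by_cases hx : x ∈ V
    · rw [hfV x hx, mul_one]
      exact ⟨fun h => h.1.ne', fun h => ⟨lt_of_le_of_ne (h0 x) (Ne.symm h), hx⟩⟩
    · rw [hfV' x hx, mul_zero]
      exact ⟨fun h => absurd h.2 hx, fun h => absurd rfl h⟩
  rw [meanOf, hind, re_map_ind_mul_pull hd,
    integral_eq_zero_iff_of_nonneg hnn (integrable_mul_continuous hh h0 h1 f),
    measureReal_eq_zero_iff, hset]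
  exact ae_iff.symm

theorem conv_nonneg {f g : BohrCompactification Γ → ℝ} (hf0 : ∀ x, 0 ≤ f x) (hg0 : ∀ x, 0 ≤ g x)
    (z : BohrCompactification Γ) : 0 ≤ conv f g z :=
  integral_nonneg fun y => mul_nonneg (hg0 y) (hf0 (z - y))

theorem conv_pos {f g : BohrCompactification Γ → ℝ} (hf : MemLp f 2 (haar Γ))
    (hf0 : ∀ x, 0 ≤ f x) (hg : Measurable g) (hg0 : ∀ x, 0 ≤ g x) (hg1 : ∀ x, g x ≤ 1)
    {z : BohrCompactification Γ} (h : 0 < haar Γ {t | z - t ∈ {x | 0 < f x} ∧ t ∈ {x | 0 < g x}}) :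
    0 < conv f g z := by
  rw [conv, integral_pos_iff_support_of_nonneg (fun y => mul_nonneg (hg0 y) (hf0 (z - y)))
    (integrable_mul_sub hf hg hg0 hg1 z)]
  exact h.trans_le (measure_mono fun t ht => (mul_pos ht.2 ht.1).ne')

/-- A mean on `Γ` vanishes on the part of a set where the density vanishes. -/
theorem map_ind_mul_pull_eq_zero {C : Set Γ} {k F : BohrCompactification Γ → ℝ}
    (hk : Measurable k) (hk0 : ∀ x, 0 ≤ k x) (hk1 : ∀ x, k x ≤ 1)
    (hkC : ∀ φ : C(BohrCompactification Γ, ℂ),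
      ν (BddFun.ind C * BddFun.pull φ) = ∫ x, (k x : ℂ) * φ x ∂(haar Γ))
    (hF : Continuous F) (hF0 : ∀ x, 0 ≤ F x) (h : ∫ z, k z * F z ∂(haar Γ) = 0)
    {φ : C(BohrCompactification Γ, ℝ)} (hφ : ∀ x, F x = 0 → φ x = 0) :
    ν (BddFun.ind C * BddFun.pull φ.complexOfReal) = 0 := by
  rw [hkC]
  rw [integral_eq_zero_iff_of_nonneg (fun z => mul_nonneg (hk0 z) (hF0 z))
    (integrable_mul_continuous hk hk0 hk1 ⟨F, hF⟩)] at h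
  refine integral_eq_zero_of_ae ?_
  filter_upwards [h] with x hx
  rcases mul_eq_zero.1 hx with hx | hx
  · simp [hx]
  · simp [hφ x hx]

end

theorem theorem3p10 {Γ : Type u} [AddCommGroup Γ] (ν η : BddFun Γ →ₗ[ℂ] ℂ)
    (hν : ν ∈ extremeInvariantMeans Γ) (hη : IsFSMean η) (A B : Set Γ) :
    ∃ A' B' : Set (BohrCompactification Γ),
      -- countable unions of compact sets
      IsSigmaCompact A' ∧ IsSigmaCompact B' ∧
      meanOf ν A ≤ (BohrCompactification.haar Γ).real A' ∧
      meanOf η B ≤ (BohrCompactification.haar Γ).real B' ∧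
      (BohrCompactification.haar Γ).real (A' + B') ≤ meanOf ν (A + B) ∧
      (∀ V : Set (BohrCompactification Γ), IsCompact V →
        meanOf ν (A ∩ BohrCompactification.ι ⁻¹' V) ≤
            (BohrCompactification.haar Γ).real (A' ∩ V) ∧
        meanOf η (B ∩ BohrCompactification.ι ⁻¹' V) ≤
            (BohrCompactification.haar Γ).real (B' ∩ V)) ∧
      (∀ V : Set (BohrCompactification Γ), IsClopen V →
        ((BohrCompactification.haar Γ).real (A' ∩ V) = 0 ↔
            meanOf ν (A ∩ BohrCompactification.ι ⁻¹' V) = 0) ∧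
        ((BohrCompactification.haar Γ).real (B' ∩ V) = 0 ↔
            meanOf η (B ∩ BohrCompactification.ι ⁻¹' V) = 0)) ∧
      (∀ V : Set (BohrCompactification Γ), IsCompact V → V ⊆ A' + B' →
        MeanSubset ν (BohrCompactification.ι ⁻¹' V) (A + B)) := by
  have hm : IsMean ν := hν.1.1
  have hinv : ∀ (γ : Γ) (f : BddFun Γ), ν (f.translate γ) = ν f := hν.1.2
  have hcν := isCharacterMean_of_invariant hm hinv
  have hcη := hη.isCharacterMean hm hinv
  obtain ⟨f, hf, hf0, hf1, hfA⟩ := hcν.exists_density A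
  obtain ⟨g, hg, hg0, hg1, hgB⟩ := hcη.exists_density B
  obtain ⟨k, hk, hk0, hk1, hkC⟩ := hcν.exists_density (A + B)ᶜ
  have hf2 := BohrCompactification.memLp_of_bounded hf hf0 hf1
  obtain ⟨A', hA', B', hB', hA'c, hB'c, hA'n, hB'n, hAB⟩ :=
    exists_isSigmaCompact_add (μ := BohrCompactification.haar Γ)
      (measurableSet_lt measurable_const hf) (measurableSet_lt measurable_const hg)
  have hcpt : ∀ V : Set (BohrCompactification Γ), IsCompact V →
      meanOf ν (A ∩ BohrCompactification.ι ⁻¹' V) ≤ (BohrCompactification.haar Γ).real (A' ∩ V) ∧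
      meanOf η (B ∩ BohrCompactification.ι ⁻¹' V) ≤ (BohrCompactification.haar Γ).real (B' ∩ V) := by
    intro V hV
    rw [measureReal_inter_eq_of_null hA' hA'n, measureReal_inter_eq_of_null hB' hB'n]
    exact ⟨meanOf_inter_le_of_isCompact hm hf hf0 hf1 hfA hV,
      meanOf_inter_le_of_isCompact hη.isMean hg hg0 hg1 hgB hV⟩
  have hconv := integral_mul_conv_eq_zero hm hinv hν hη (A := A) (B := B) (C := (A + B)ᶜ)
    (fun b hb a ha h => h (Set.add_mem_add ha hb)) hf hf0 hf1 hfA hg hg0 hg1 hgB hk hk0 hk1 hkC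
  have hcont := BohrCompactification.continuous_conv hf2 hg hg0 hg1
  have hpos : ∀ z ∈ A' + B', 0 < BohrCompactification.conv f g z := by
    rintro _ ⟨x, hx, y, hy, rfl⟩
    exact conv_pos hf2 hf0 hg hg0 hg1 (hAB x hx y hy)
  -- The open set `{conv f g > 0}` leaves room for a continuous cut-off around `V`. The density `k`
  -- vanishes almost everywhere there, so the complement of `A + B` contributes nothing.
  have hury : ∀ V : Set (BohrCompactification Γ), IsCompact V → V ⊆ A' + B' →
      ∃ φ : C(BohrCompactification Γ, ℝ), (∀ x, 0 ≤ φ x ∧ φ x ≤ 1) ∧ (∀ x ∈ V, φ x = 1) ∧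
        ν (BddFun.ind (A + B)ᶜ * BddFun.pull φ.complexOfReal) = 0 := by
    intro V hV hVAB
    obtain ⟨φ, hφ, hφV, hφU⟩ := exists_urysohn hV (isOpen_lt continuous_const hcont)
      fun z hz => hpos z (hVAB hz)
    exact ⟨φ, hφ, hφV, map_ind_mul_pull_eq_zero hk hk0 hk1 hkC hcont (conv_nonneg hf0 hg0) hconv
      fun x hx => hφU x fun h : 0 < BohrCompactification.conv f g x => h.ne' hx⟩
  refine ⟨A', B', hA'c, hB'c, by simpa using (hcpt _ isCompact_univ).1,
    by simpa using (hcpt _ isCompact_univ).2, ?_, hcpt, fun V hV => ?_, fun V hV hVAB => ?_⟩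
  · have hle : ∀ V : Set (BohrCompactification Γ), IsCompact V → V ⊆ A' + B' →
        (BohrCompactification.haar Γ).real V ≤ meanOf ν (A + B) := by
      intro V hV hVAB
      obtain ⟨φ, hφ, hφV, hφ0⟩ := hury V hV hVAB
      have h1 : (BohrCompactification.haar Γ).real V ≤ ∫ x, φ x ∂(BohrCompactification.haar Γ) := by
        rw [← integral_indicator_one hV.measurableSet]
        refine integral_mono ((integrable_const (1 : ℝ)).indicator hV.measurableSet)
          ((BohrCompactification.memLp_continuous φ).integrable (by norm_num)) fun x => ?_
        by_cases hx : x ∈ V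
        · rw [Set.indicator_of_mem hx, hφV x hx]; rfl
        · rw [Set.indicator_of_notMem hx]; exact (hφ x).1
      have h2 : ν (BddFun.pull φ.complexOfReal) =
          ((∫ x, φ x ∂(BohrCompactification.haar Γ) : ℝ) : ℂ) := by
        rw [hcν.map_pull, ← integral_complex_ofReal]
        rfl
      -- The function `φ` is at most `1` on `A + B`, and its part on the complement has mean zero.
      have h3 : ν (BddFun.pull φ.complexOfReal) ≤ ν (BddFun.ind (A + B) +
          BddFun.ind (A + B)ᶜ * BddFun.pull φ.complexOfReal) := hm.mono fun x => by
        rw [BddFun.add_apply', BddFun.mul_apply', BddFun.pull_apply,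
          ContinuousMap.complexOfReal_apply]
        by_cases hx : x ∈ A + B
        · rw [BddFun.ind_of_mem hx, BddFun.ind_of_notMem (Set.notMem_compl_iff.2 hx), zero_mul, add_zero,
            ← Complex.ofReal_one, Complex.real_le_real]
          exact (hφ _).2
        · rw [BddFun.ind_of_notMem hx, BddFun.ind_of_mem (show x ∈ (A + B)ᶜ from hx), one_mul,
            zero_add]
      rw [map_add, hφ0, add_zero, h2] at h3
      exact h1.trans (Complex.le_def.1 h3).1
    -- A sum of σ-compact sets is a countable union of compact sets, so inner regularity reduces the
    -- bound to compact subsets.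
    have hmeas : MeasurableSet (A' + B') := by
      obtain ⟨K, hK, rfl⟩ := hA'c
      obtain ⟨L, hL, rfl⟩ := hB'c
      rw [Set.iUnion_add]
      refine MeasurableSet.iUnion fun i => ?_
      rw [Set.add_iUnion]
      exact MeasurableSet.iUnion fun j => ((hK i).add (hL j)).measurableSet
    refine ENNReal.toReal_le_of_le_ofReal (hm.nonneg_meanOf _) ?_
    rw [hmeas.measure_eq_iSup_isCompact_of_ne_top (measure_ne_top _ _)]
    refine iSup₂_le fun K hK => iSup_le fun hKc => ?_
    rw [← ofReal_measureReal]
    exact ENNReal.ofReal_le_ofReal (hle K hKc hK)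
  · rw [measureReal_inter_eq_of_null hA' hA'n, measureReal_inter_eq_of_null hB' hB'n]
    exact ⟨measureReal_inter_eq_zero_iff hf hf0 hf1 hfA hV,
      measureReal_inter_eq_zero_iff hg hg0 hg1 hgB hV⟩
  · obtain ⟨φ, hφ, hφV, hφ0⟩ := hury V hV hVAB
    refine le_antisymm ?_ (hm.nonneg_meanOf _)
    have h := hm.meanOf_le (A := BohrCompactification.ι ⁻¹' V \ (A + B))
      (f := BddFun.ind (A + B)ᶜ * BddFun.pull φ.complexOfReal) fun x => by
        by_cases hx : x ∈ BohrCompactification.ι ⁻¹' V \ (A + B)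
        · rw [BddFun.ind_of_mem hx, BddFun.mul_apply', BddFun.ind_of_mem
            (show x ∈ (A + B)ᶜ from hx.2), BddFun.pull_apply, ContinuousMap.complexOfReal_apply,
            hφV _ hx.1]
          simp
        · rw [BddFun.ind_of_notMem hx]
          exact mul_nonneg (BddFun.ind_nonneg _ x) (Complex.zero_le_real.2 (hφ _).1)
    rwa [hφ0] at h
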